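/- Let $\alpha>-1$. For $\beta=\pm\frac12$ and $N\ge 0$ let $\{P_n^{\alpha,\beta,0,N}(t)\}_{n\ge0}$ be polynomials (in any normalization) with $\deg P_n^{\alpha,\beta,0,N}=n$ which are mutually orthogonal with respect to $$\langle f,g\rangle=\frac{\Gamma(\alpha+\beta+2)}{2^{\alpha+\beta+1}\Gamma(\alpha+1)\Gamma(\beta+1)}\int_{-1}^{1}f(x)g(x)(1-x)^{\alpha}(1+x)^{\beta}\,dx+N f(1)g(1).$$ Write $\binom{x}{k}=x(x-1)\cdots(x-k+1)/k!$ for integers $k\ge0$ and $\binom{x}{k}=0$ for integers $k<0$. For $i\ge1$ put $$c_i(x)=(2\alpha+3)(1-x^2)\frac{2^i}{i!}\sum_{k=0}^{i-2}\binom{\alpha+1}{i-k-2}\binom{i-2\alpha-5}{k}\Bigl(\frac{1-x}{2}\Bigr)^k$$ (so $c_1=0$), and for $j\ge1$ put $$d_j(x)=\sum_{i=j}^{2j}\frac{i!\,2^{3j-i}}{(2j-i)!\,(i-j)!}x^{2j-i}c_i(x),\qquad e_j(x)=\sum_{i=j}^{2j+1}\frac{(i+1)!\,2^{3j-i}}{(2j-i+1)!\,(i-j)!}x^{2j-i}c_i(x)\quad(x\neq0).$$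 (a) For every $j\ge1$ there is a polynomial $d_j^*$ of degree $\le j$ with $d_j^*(t)=\frac18 d_j\bigl(\sqrt{(1+t)/2}\bigr)$ for all $t\ge-1$. With $d_0^*=\frac12(2\alpha+3)\binom{2n+2\alpha+2}{2n-2}$ (the only one of these coefficients that depends on $n$), for all $N\ge0$ and $n\ge0$ the polynomial $y=P_n^{\alpha,-1/2,0,N}$ satisfies, for all real $t$, $$N\sum_{j=0}^{\infty}d_j^*(t)y^{(j)}(t)+(1-t^2)y''(t)-\tfrac12\bigl[(2\alpha+1)+(2\alpha+3)t\bigr]y'(t)+\tfrac12n(2n+2\alpha+1)y(t)=0.$$ (b) For every $j\ge1$ there is a polynomial $e_j^*$ of degree $\le j$ with $e_j^*(t)=\frac1{8(2\alpha+3)}e_j\bigl(\sqrt{(1+t)/2}\bigr)$ for all $t>-1$. With $e_0^*=\frac12\binom{2n+2\alpha+3}{2n-1}$ (the only one of these coefficients that depends on $n$), for all $N\ge0$ and $n\ge0$ the polynomial $y=P_n^{\alpha,1/2,0,N}$ satisfies, for all real $t$, $$N\sum_{j=0}^{\infty}e_j^*(t)y^{(j)}(t)+(1-t^2)y''(t)-\tfrac12\bigl[(2\alpha-1)+(2\alpha+5)t\bigr]y'(t)+\tfrac12n(2n+2\alpha+3)y(t)=0.$$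 (c) Let $N>0$, and define the order of a differential equation $\sum_j A_j(t)y^{(j)}(t)=0$ as the supremum of the $j$ for which $A_j$ is not identically zero. If $\alpha$ is not a nonnegative integer, both equations have infinite order; if $\alpha$ is a nonnegative integer, both equations have order exactly $2\alpha+4$. -/

import Mathlib

open Polynomial

noncomputable section

/-- The symmetric bilinear form
`Γ(α+β+2) / (2^(α+β+1) Γ(α+1) Γ(β+1)) ∫_{-1}^{1} f g (1-x)^α (1+x)^β dx + M f(-1) g(-1) + N f(1) g(1)`
on real polynomials. -/
def genJacobiInner (α β M N : ℝ) (f g : ℝ[X]) : ℝ :=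
  Real.Gamma (α + β + 2) / ((2 : ℝ) ^ (α + β + 1) * Real.Gamma (α + 1) * Real.Gamma (β + 1)) *
      (∫ x in (-1 : ℝ)..1, (1 - x) ^ α * (1 + x) ^ β * (f.eval x * g.eval x)) +
    M * (f.eval (-1) * g.eval (-1)) + N * (f.eval 1 * g.eval 1)

/-- `P n = P_n^{α,β,M,N}`: the polynomials `P n` have degree exactly `n` and are mutually
orthogonal for the generalized Jacobi weight. (This determines each `P n` up to a nonzero constant
factor; no normalization is imposed.) -/
structure IsGenJacobi (α β M N : ℝ) (P : ℕ → ℝ[X]) : Prop where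
  degree_eq : ∀ n : ℕ, (P n).degree = (n : WithBot ℕ)
  orthogonal : ∀ m n : ℕ, m ≠ n → genJacobiInner α β M N (P m) (P n) = 0

/-- The generalized binomial coefficient `x(x-1)⋯(x-k+1)/k!`, equal to `0` for `k < 0`. -/
def binom (x : ℝ) (k : ℤ) : ℝ :=
  if k < 0 then 0 else Ring.choose x k.toNat

/-- The coefficients `c_i(x)`, `i ≥ 1`; the sum over `k` runs from `0` to `i - 2` (empty if
`i = 1`). Only indices `i ≥ 1` are used. -/
def cCoeff (α : ℝ) (i : ℕ) (x : ℝ) : ℝ :=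
  (2 * α + 3) * (1 - x ^ 2) * ((2 : ℝ) ^ i / (i.factorial : ℝ) *
    ∑ k ∈ Finset.range (i - 1),
      binom (α + 1) ((i : ℤ) - k - 2) * binom ((i : ℝ) - 2 * α - 5) k * ((1 - x) / 2) ^ k)

/-- The coefficients `d_j(x)`, `j ≥ 1`. -/
def dCoeff (α : ℝ) (j : ℕ) (x : ℝ) : ℝ :=
  ∑ i ∈ Finset.Icc j (2 * j),
    ((i.factorial : ℝ) * 2 ^ (3 * j - i)) /
      (((2 * j - i).factorial : ℝ) * ((i - j).factorial : ℝ)) * x ^ (2 * j - i) * cCoeff α i x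

/-- The coefficients `e_j(x)`, `j ≥ 1`, `x ≠ 0`; for `i = 2j + 1` the power `x ^ (2j - i)` is
`x⁻¹`. -/
def eCoeff (α : ℝ) (j : ℕ) (x : ℝ) : ℝ :=
  ∑ i ∈ Finset.Icc j (2 * j + 1),
    (((i + 1).factorial : ℝ) * 2 ^ (3 * j - i)) /
      (((2 * j + 1 - i).factorial : ℝ) * ((i - j).factorial : ℝ)) *
      x ^ (2 * (j : ℤ) - (i : ℤ)) * cCoeff α i x

/-- The coefficient family with constant zeroth term `a` and `j`-th term `d j` for `j ≥ 1`. -/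
def withZeroth (a : ℝ) (d : ℕ → ℝ[X]) : ℕ → ℝ[X]
  | 0 => C a
  | j + 1 => d (j + 1)

/-- The value `∑_{j=0}^∞ D_j(t) y^{(j)}(t)` for a polynomial `y` (only finitely many terms are
nonzero). -/
def seriesOp (D : ℕ → ℝ[X]) (y : ℝ[X]) (t : ℝ) : ℝ :=
  ∑' j : ℕ, (D j).eval t * (derivative^[j] y).eval t

/-- The coefficient of `y^{(j)}` in `N ∑_j D_j y^{(j)} + p₂ y'' + p₁ y' + p₀ y = 0`. -/
def eqCoeff (N : ℝ) (D : ℕ → ℝ[X]) (p₂ p₁ p₀ : ℝ[X]) : ℕ → ℝ[X]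
  | 0 => C N * D 0 + p₀
  | 1 => C N * D 1 + p₁
  | 2 => C N * D 2 + p₂
  | j + 3 => C N * D (j + 3)

/-- The order of the differential equation `∑_j A_j(t) y^{(j)}(t) = 0`: the supremum in `ℕ∞` of the
indices `j` for which the coefficient `A_j` is not identically zero. -/
def diffOrder (A : ℕ → ℝ[X]) : ℕ∞ :=
  ⨆ (j : ℕ) (_ : A j ≠ 0), (j : ℕ∞)

end

noncomputable section

/-! ### Generalized binomial coefficients -/

theorem Ring.choose_eq_descPochhammer_eval_div (z : ℝ) (k : ℕ) :
    Ring.choose z k = (descPochhammer ℝ k).eval z / (k.factorial : ℝ) := by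
  have h := Ring.descPochhammer_eq_factorial_smul_choose z k
  have h2 : (descPochhammer ℤ k).smeval z = (descPochhammer ℝ k).eval z := by
    rw [← descPochhammer_map (Int.castRingHom ℝ), eval_map, ← Polynomial.aeval_eq_smeval]
    rfl
  rw [← h2, h, nsmul_eq_mul]
  field_simp

theorem Ring.succ_mul_choose_succ (z : ℝ) (k : ℕ) :
    ((k : ℝ) + 1) * Ring.choose z (k + 1) = (z - k) * Ring.choose z k := by
  rw [Ring.choose_eq_descPochhammer_eval_div, Ring.choose_eq_descPochhammer_eval_div,
    descPochhammer_succ_right, Nat.factorial_succ]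
  have : (k.factorial : ℝ) ≠ 0 := by positivity
  simp only [eval_mul, eval_sub, eval_X, eval_natCast]
  push_cast
  field_simp

theorem Ring.succ_mul_choose_succ' (z : ℝ) (k : ℕ) :
    ((k : ℝ) + 1) * Ring.choose z (k + 1) = z * Ring.choose (z - 1) k := by
  rw [Ring.choose_eq_descPochhammer_eval_div, Ring.choose_eq_descPochhammer_eval_div,
    descPochhammer_succ_left, Nat.factorial_succ]
  have : (k.factorial : ℝ) ≠ 0 := by positivity
  simp only [eval_mul, eval_comp, eval_sub, eval_X, eval_one]
  push_cast
  field_simp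

theorem Ring.choose_ne_zero_of_forall_ne {z : ℝ} {k : ℕ} (h : ∀ j : ℕ, j < k → z ≠ j) :
    Ring.choose z k ≠ 0 := by
  induction k with
  | zero => simp
  | succ k ih =>
    have h1 := Ring.succ_mul_choose_succ z k
    intro h0
    rw [h0, mul_zero] at h1
    rcases mul_eq_zero.1 h1.symm with h2 | h2
    · exact h k (by omega) (by linarith)
    · exact ih (fun j hj => h j (by omega)) h2

theorem Ring.add_choose_eq_sum_range (r s : ℝ) (k : ℕ) :
    Ring.choose (r + s) k =
      ∑ i ∈ Finset.range (k + 1), Ring.choose r i * Ring.choose s (k - i) := by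
  rw [Ring.add_choose_eq k (Commute.all r s), Finset.Nat.sum_antidiagonal_eq_sum_range_succ_mk]

theorem Polynomial.eq_zero_of_derivative_eq_zero_of_eval {p : ℝ[X]} {x : ℝ}
    (h : derivative p = 0) (hx : p.eval x = 0) : p = 0 := by
  have := derivative_eq_zero.1 h
  rw [eq_C_of_natDegree_eq_zero this] at hx ⊢
  simp at hx
  simp [hx]

/-! ### The polynomials `[w^m] (1 + x w - (1 - x²) w² / 4)^a` -/

/-- The coefficient of `w ^ m` in `(1 + x w - (1 - x²) w² / 4) ^ a`. -/
def quadPow (a : ℝ) (m : ℕ) : ℝ[X] :=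
  ∑ k ∈ Finset.range (m + 1),
    C (Ring.choose a (m - k) * Ring.choose (m - 2 * a - 1) k) * (C (1 / 2) * (1 - X)) ^ k

theorem quadPow_zero (a : ℝ) : quadPow a 0 = 1 := by simp [quadPow]

theorem quadPow_eval_one (a : ℝ) (m : ℕ) : (quadPow a m).eval 1 = Ring.choose a m := by
  rw [quadPow, eval_finsetSum, Finset.sum_range_succ']
  simp

theorem derivative_quadPow_succ (a : ℝ) (m : ℕ) :
    derivative (quadPow a (m + 1)) = C ((2 * a - m) / 2) * quadPow a m := by
  rw [quadPow, Finset.sum_range_succ', quadPow, derivative_add, derivative_sum, Finset.mul_sum]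
  simp only [pow_zero, mul_one, derivative_C, add_zero]
  refine Finset.sum_congr rfl fun k _ => ?_
  have h := Ring.succ_mul_choose_succ' ((m + 1 : ℕ) - 2 * a - 1) k
  rw [show ((m + 1 : ℕ) - 2 * a - 1 - 1 : ℝ) = m - 2 * a - 1 by push_cast; ring] at h
  rw [Nat.add_sub_add_right, derivative_C_mul, derivative_pow, derivative_C_mul]
  simp only [derivative_sub, derivative_one, derivative_X, Nat.add_sub_cancel]
  have e : ((k : ℝ) + 1) * Ring.choose ((m + 1 : ℕ) - 2 * a - 1) (k + 1) * (-(1 / 2)) =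
      (2 * a - m) / 2 * Ring.choose (m - 2 * a - 1) k := by
    rw [h]; push_cast; ring
  have e2 := congrArg C e
  simp only [C_mul, C_neg] at e2
  simp only [C_mul, ← mul_assoc]
  linear_combination (C (Ring.choose a (m - k)) * (C (1 / 2) * (1 - X)) ^ k) * e2 +
    (-C (Ring.choose a (m - k)) * C (Ring.choose (((m + 1 : ℕ) : ℝ) - 2 * a - 1) (k + 1)) *
      (C (1 / 2) * (1 - X)) ^ k * C (1 / 2)) * (by simp : (C (((k + 1 : ℕ) : ℝ)) : ℝ[X]) = C ((k : ℝ) + 1))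

theorem quadPow_one (a : ℝ) : quadPow a 1 = C a * X := by
  rw [← sub_eq_zero]
  refine eq_zero_of_derivative_eq_zero_of_eval (x := 1) ?_ ?_
  · rw [derivative_sub, derivative_quadPow_succ a 0, quadPow_zero]
    simp
  · simp [quadPow_eval_one]

theorem quadPow_succ_succ (a : ℝ) (m : ℕ) :
    C ((m : ℝ) + 2) * quadPow a (m + 2) = C (a - m - 1) * X * quadPow a (m + 1) -
      C ((2 * a - m) / 4) * (1 - X ^ 2) * quadPow a m := by
  rw [← sub_eq_zero]
  induction m with
  | zero =>
    refine eq_zero_of_derivative_eq_zero_of_eval (x := 1) ?_ ?_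
    · simp only [derivative_sub, derivative_mul, derivative_C, derivative_X, derivative_quadPow_succ,
        quadPow_zero, quadPow_one, derivative_one, derivative_X_pow]
      refine funext fun x => ?_
      simp [quadPow_one]
      ring
    · have := Ring.succ_mul_choose_succ a 1
      simp [quadPow_eval_one] at this ⊢
      linarith
  | succ m ih =>
    refine eq_zero_of_derivative_eq_zero_of_eval (x := 1) ?_ ?_
    · have h : C ((2 * a - (m + 1 : ℕ)) / 2) * (C ((m : ℝ) + 2) * quadPow a (m + 2) -
          (C (a - m - 1) * X * quadPow a (m + 1) -
            C ((2 * a - m) / 4) * (1 - X ^ 2) * quadPow a m)) = 0 := by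
        rw [ih, mul_zero]
      rw [← h]
      simp only [derivative_sub, derivative_mul, derivative_C, derivative_X, derivative_quadPow_succ,
        derivative_one, derivative_X_pow]
      refine funext fun x => ?_
      simp
      ring
    · have := Ring.succ_mul_choose_succ a (m + 2)
      simp [quadPow_eval_one] at this ⊢
      ring_nf at this ⊢
      linarith

theorem quadPow_add_one (a : ℝ) (m : ℕ) :
    quadPow (a + 1) (m + 2) = quadPow a (m + 2) + X * quadPow a (m + 1) +
      C (1 / 4) * (X ^ 2 - 1) * quadPow a m := by
  have key : ∀ m : ℕ, (quadPow a (m + 2) + X * quadPow a (m + 1) +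
      C (1 / 4) * (X ^ 2 - 1) * quadPow a m).eval 1 = Ring.choose (a + 1) (m + 2) := by
    intro m
    simp [quadPow_eval_one, Ring.choose_succ_succ]
    ring
  rw [← sub_eq_zero]
  induction m with
  | zero =>
    refine eq_zero_of_derivative_eq_zero_of_eval (x := 1) ?_ ?_
    · simp only [derivative_sub, derivative_add, derivative_mul, derivative_C, derivative_X,
        derivative_quadPow_succ, quadPow_zero, quadPow_one, derivative_one, derivative_X_pow]
      refine funext fun x => ?_
      simp [quadPow_one]
      ring
    · rw [eval_sub, key, quadPow_eval_one, sub_self]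
  | succ m ih =>
    refine eq_zero_of_derivative_eq_zero_of_eval (x := 1) ?_ ?_
    · have h : C ((2 * a - m) / 2) * (quadPow (a + 1) (m + 2) - (quadPow a (m + 2) +
          X * quadPow a (m + 1) + C (1 / 4) * (X ^ 2 - 1) * quadPow a m)) = 0 := by
        rw [ih, mul_zero]
      rw [← h]
      simp only [derivative_sub, derivative_add, derivative_mul, derivative_C, derivative_X,
        derivative_quadPow_succ, derivative_one, derivative_X_pow]
      refine funext fun x => ?_
      simp
      ring
    · rw [eval_sub, key, quadPow_eval_one, sub_self]

theorem quadPow_add_one_one (a : ℝ) : quadPow (a + 1) 1 = quadPow a 1 + X * quadPow a 0 := by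
  simp [quadPow_one, quadPow_zero]; ring

theorem natDegree_quadPow_le (a : ℝ) (m : ℕ) : (quadPow a m).natDegree ≤ m := by
  refine natDegree_sum_le_of_forall_le _ _ fun k hk => ?_
  refine (natDegree_C_mul_le _ _).trans ((natDegree_pow_le).trans ?_)
  have : (C (1 / 2) * (1 - X) : ℝ[X]).natDegree ≤ 1 := by compute_degree
  have := Finset.mem_range.1 hk
  nlinarith

theorem coeff_quadPow_self (a : ℝ) (m : ℕ) :
    (quadPow a m).coeff m = Ring.choose (2 * a) m / 2 ^ m := by
  induction m with
  | zero => simp [quadPow_zero]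
  | succ m ih =>
    have h := congrArg (fun p => p.coeff m) (derivative_quadPow_succ a m)
    simp only [coeff_derivative, coeff_C_mul, ih] at h
    have h2 := Ring.succ_mul_choose_succ (2 * a) m
    have hm : (m : ℝ) + 1 ≠ 0 := by positivity
    apply mul_right_cancel₀ hm
    rw [h, pow_succ]
    field_simp
    linarith

theorem quadPow_comp_neg_X (a : ℝ) (m : ℕ) :
    (quadPow a m).comp (-X) = (-1) ^ m * quadPow a m := by
  induction m using Nat.strong_induction_on with
  | _ m ih =>
    match m with
    | 0 => simp [quadPow_zero]
    | 1 => simp [quadPow_one]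
    | m + 2 =>
      have hm : (C ((m : ℝ) + 2) : ℝ[X]) ≠ 0 := by
        rw [Ne, C_eq_zero]; positivity
      apply mul_left_cancel₀ hm
      have h := congrArg (fun p => p.comp (-X)) (quadPow_succ_succ a m)
      simp only [mul_comp, sub_comp, C_comp, X_comp, one_comp, pow_comp, ih m (by omega),
        ih (m + 1) (by omega)] at h
      rw [h]
      linear_combination (-(-1) ^ m) * quadPow_succ_succ a m

theorem quadPow_natCast_eq_zero (k : ℕ) {m : ℕ} (hm : 2 * k < m) : quadPow (k : ℝ) m = 0 := by
  induction m, hm using Nat.le_induction with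
  | base =>
    refine eq_zero_of_derivative_eq_zero_of_eval (x := 1) ?_ ?_
    · simp [derivative_quadPow_succ]
    · rw [quadPow_eval_one, Ring.choose_natCast, Nat.choose_eq_zero_of_lt (by omega), Nat.cast_zero]
  | succ m hm ih =>
    refine eq_zero_of_derivative_eq_zero_of_eval (x := 1) ?_ ?_
    · simp [derivative_quadPow_succ, ih]
    · rw [quadPow_eval_one, Ring.choose_natCast, Nat.choose_eq_zero_of_lt (by omega), Nat.cast_zero]

theorem quadPow_natCast_two_mul_ne_zero (k : ℕ) : quadPow (k : ℝ) (2 * k) ≠ 0 := by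
  intro h
  have := coeff_quadPow_self k (2 * k)
  have e : (2 * (k : ℝ)) = ((2 * k : ℕ) : ℝ) := by push_cast; ring
  rw [h, e, Ring.choose_natCast] at this
  simp only [coeff_zero, Nat.choose_self, Nat.cast_one] at this
  exact absurd this (by positivity)

/-! ### The operators `∑ 2^(m+r) / (m+r)! [w^m] (1 + x w - (1 - x²) w² / 4)^a ∂^(m+r)` -/

/-- The differential operator
`∑ m, 2 ^ (m + r) / (m + r)! * [w ^ m] (1 + x w - (1 - x²) w² / 4) ^ a * ∂ ^ (m + r)`. -/
def quadOp (a : ℝ) (r : ℕ) (f : ℝ[X]) : ℝ[X] :=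
  ∑ m ∈ Finset.range (f.natDegree + 1),
    C (2 ^ (m + r) / ((m + r).factorial : ℝ)) * quadPow a m * derivative^[m + r] f

theorem quadOp_eq_sum (a : ℝ) (r : ℕ) {f : ℝ[X]} {K : ℕ} (hK : f.natDegree < K) :
    quadOp a r f = ∑ m ∈ Finset.range K,
      C (2 ^ (m + r) / ((m + r).factorial : ℝ)) * quadPow a m * derivative^[m + r] f := by
  refine Finset.sum_subset (Finset.range_subset_range.2 hK) fun m _ hm => ?_
  rw [Finset.mem_range] at hm
  rw [iterate_derivative_eq_zero (by omega), mul_zero]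

theorem quadOp_add (a : ℝ) (r : ℕ) (f g : ℝ[X]) :
    quadOp a r (f + g) = quadOp a r f + quadOp a r g := by
  have h1 := natDegree_add_le f g
  have h2 : f.natDegree < max f.natDegree g.natDegree + 1 := by omega
  have h3 : g.natDegree < max f.natDegree g.natDegree + 1 := by omega
  rw [quadOp_eq_sum a r (Nat.lt_succ_of_le h1), quadOp_eq_sum a r h2, quadOp_eq_sum a r h3,
    ← Finset.sum_add_distrib]
  exact Finset.sum_congr rfl fun m _ => by rw [iterate_map_add]; ring

theorem quadOp_C_mul (a : ℝ) (r : ℕ) (c : ℝ) (f : ℝ[X]) :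
    quadOp a r (C c * f) = C c * quadOp a r f := by
  rw [quadOp_eq_sum a r (Nat.lt_succ_of_le (natDegree_C_mul_le c f)),
    quadOp_eq_sum a r (Nat.lt_succ_self f.natDegree), Finset.mul_sum]
  exact Finset.sum_congr rfl fun m _ => by rw [iterate_derivative_C_mul]; ring

theorem quadOp_sub (a : ℝ) (r : ℕ) (f g : ℝ[X]) :
    quadOp a r (f - g) = quadOp a r f - quadOp a r g := by
  have := quadOp_add a r f (C (-1) * g)
  rw [quadOp_C_mul] at this
  simpa [sub_eq_add_neg] using this

theorem quadOp_eq_zero (a : ℝ) (r : ℕ) {f : ℝ[X]} (hf : f.natDegree < r) : quadOp a r f = 0 :=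
  Finset.sum_eq_zero fun m _ => by rw [iterate_derivative_eq_zero (by omega), mul_zero]

theorem derivative_quadOp (a : ℝ) (r : ℕ) (f : ℝ[X]) :
    derivative (quadOp a r f) = C ((2 * a + r + 1) / 2) * quadOp a (r + 1) f := by
  rw [quadOp_eq_sum a r (K := f.natDegree + 1 + 1) (by omega), quadOp, derivative_sum]
  have e : ∀ m, derivative (C (2 ^ (m + r) / ((m + r).factorial : ℝ)) * quadPow a m *
      derivative^[m + r] f) =
      C (2 ^ (m + r) / ((m + r).factorial : ℝ)) * derivative (quadPow a m) * derivative^[m + r] f +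
      C (2 ^ (m + r) / ((m + r).factorial : ℝ)) * quadPow a m * derivative^[m + r + 1] f := by
    intro m
    rw [derivative_mul, derivative_C_mul, Function.iterate_succ_apply']
  simp only [e]
  rw [Finset.sum_add_distrib, Finset.sum_range_succ' (n := f.natDegree + 1),
    Finset.sum_range_succ (n := f.natDegree + 1),
    iterate_derivative_eq_zero (x := f.natDegree + 1 + r + 1) (by omega), quadPow_zero,
    derivative_one, mul_zero, mul_zero, zero_mul, add_zero, add_zero, ← Finset.sum_add_distrib,
    Finset.mul_sum]
  refine Finset.sum_congr rfl fun m _ => ?_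
  rw [derivative_quadPow_succ, show m + 1 + r = m + r + 1 by omega, ← add_assoc m r 1,
    Nat.factorial_succ]
  have h : (2 ^ (m + r + 1) / (((m + r + 1) * (m + r).factorial : ℕ) : ℝ)) * ((2 * a - m) / 2) +
      2 ^ (m + r) / ((m + r).factorial : ℝ) =
      (2 * a + r + 1) / 2 * (2 ^ (m + r + 1) / (((m + r + 1) * (m + r).factorial : ℕ) : ℝ)) := by
    have : ((m + r).factorial : ℝ) ≠ 0 := by positivity
    have : (m : ℝ) + r + 1 ≠ 0 := by positivity
    push_cast
    field_simp
    ring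
  have h2 := congrArg C h
  rw [C_add, C_mul, C_mul] at h2
  linear_combination (quadPow a m * derivative^[m + r + 1] f) * h2

theorem iterate_derivative_X_sq_sub_one_mul (g : ℝ[X]) (m : ℕ) :
    derivative^[m + 2] ((X ^ 2 - 1) * g) = (X ^ 2 - 1) * derivative^[m + 2] g +
      C (2 * ((m : ℝ) + 2)) * X * derivative^[m + 1] g +
      C (((m : ℝ) + 2) * (m + 1)) * derivative^[m] g := by
  induction m with
  | zero =>
    simp only [Function.iterate_succ_apply', Function.iterate_zero_apply, derivative_mul,
      derivative_sub, derivative_add, derivative_X_pow, derivative_one]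
    refine funext fun x => ?_
    simp
    ring
  | succ m ih =>
    rw [show m + 1 + 2 = (m + 2) + 1 by ring, Function.iterate_succ_apply', ih]
    simp only [derivative_add, derivative_mul, derivative_sub, derivative_X_pow, derivative_one,
      derivative_C, derivative_X, ← Function.iterate_succ_apply']
    refine funext fun x => ?_
    simp
    ring

theorem quadOp_two_X_sq_sub_one_mul (a : ℝ) (g : ℝ[X]) :
    quadOp a 2 ((X ^ 2 - 1) * g) = C 4 * quadOp (a + 1) 0 g := by
  have hd : ((X ^ 2 - 1) * g).natDegree < g.natDegree + 1 + 2 := by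
    have h1 : (X ^ 2 - 1 : ℝ[X]).natDegree ≤ 2 := by compute_degree
    have h2 := natDegree_mul_le (p := (X ^ 2 - 1 : ℝ[X])) (q := g)
    omega
  rw [quadOp_eq_sum a 2 hd, quadOp_eq_sum (a + 1) 0 (K := g.natDegree + 1 + 2) (by omega)]
  have e : ∀ m, C (2 ^ (m + 2) / ((m + 2).factorial : ℝ)) * quadPow a m *
      derivative^[m + 2] ((X ^ 2 - 1) * g) =
      C (2 ^ (m + 2) / ((m + 2).factorial : ℝ)) * quadPow a m * (X ^ 2 - 1) *
        derivative^[m + 2] g +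
      C (2 ^ (m + 3) / ((m + 1).factorial : ℝ)) * quadPow a m * X * derivative^[m + 1] g +
      C (2 ^ (m + 2) / (m.factorial : ℝ)) * quadPow a m * derivative^[m] g := by
    intro m
    have h1 : (2 : ℝ) ^ (m + 2) / ((m + 2).factorial : ℝ) * (2 * ((m : ℝ) + 2)) =
        2 ^ (m + 3) / ((m + 1).factorial : ℝ) := by
      rw [Nat.factorial_succ (m + 1)]
      have : ((m + 1).factorial : ℝ) ≠ 0 := by positivity
      push_cast
      field_simp
      ring
    have h2 : (2 : ℝ) ^ (m + 2) / ((m + 2).factorial : ℝ) * (((m : ℝ) + 2) * (m + 1)) =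
        2 ^ (m + 2) / (m.factorial : ℝ) := by
      rw [Nat.factorial_succ (m + 1), Nat.factorial_succ m]
      have : (m.factorial : ℝ) ≠ 0 := by positivity
      push_cast
      field_simp
      ring
    rw [iterate_derivative_X_sq_sub_one_mul, ← h1, ← h2, C_mul, C_mul]
    simp only [C_mul]
    ring
  simp only [e, Finset.sum_add_distrib, add_zero]
  have z1 : derivative^[g.natDegree + 1] g = 0 := iterate_derivative_eq_zero (by omega)
  have z2 : derivative^[g.natDegree + 2] g = 0 := iterate_derivative_eq_zero (by omega)
  have z3 : derivative^[g.natDegree + 3] g = 0 := iterate_derivative_eq_zero (by omega)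
  have z4 : derivative^[g.natDegree + 4] g = 0 := iterate_derivative_eq_zero (by omega)
  have s1 : ∀ F : ℕ → ℝ[X], ∑ m ∈ Finset.range (g.natDegree + 1 + 2), F m =
      F 0 + F 1 + ∑ m ∈ Finset.range (g.natDegree + 1), F (m + 2) := by
    intro F
    rw [Finset.sum_range_succ' F (g.natDegree + 1 + 1),
      Finset.sum_range_succ' (fun k => F (k + 1)) (g.natDegree + 1)]
    ring
  have s2 : ∀ F : ℕ → ℝ[X], F (g.natDegree + 2) = 0 →
      ∑ m ∈ Finset.range (g.natDegree + 1 + 2), F m =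
      F 0 + ∑ m ∈ Finset.range (g.natDegree + 1), F (m + 1) := by
    intro F h
    rw [Finset.sum_range_succ F (g.natDegree + 1 + 1), Finset.sum_range_succ' F (g.natDegree + 1)]
    rw [show g.natDegree + 1 + 1 = g.natDegree + 2 by ring, h]
    ring
  have s3 : ∀ F : ℕ → ℝ[X], F (g.natDegree + 1) = 0 → F (g.natDegree + 2) = 0 →
      ∑ m ∈ Finset.range (g.natDegree + 1 + 2), F m =
      ∑ m ∈ Finset.range (g.natDegree + 1), F m := by
    intro F h h'
    rw [Finset.sum_range_succ F (g.natDegree + 1 + 1), Finset.sum_range_succ F (g.natDegree + 1),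
      h, h', add_zero, add_zero]
  rw [s3 _ (by simp [z3]) (by simp [z4]), s2 _ (by simp [z3]), s1, s1, mul_add, mul_add,
    Finset.mul_sum]
  have hsum : (∑ m ∈ Finset.range (g.natDegree + 1),
        C (2 ^ (m + 2) / ((m + 2).factorial : ℝ)) * quadPow a m * (X ^ 2 - 1) *
          derivative^[m + 2] g) +
      (∑ m ∈ Finset.range (g.natDegree + 1),
        C (2 ^ (m + 1 + 3) / ((m + 1 + 1).factorial : ℝ)) * quadPow a (m + 1) * X *
          derivative^[m + 1 + 1] g) +
      (∑ m ∈ Finset.range (g.natDegree + 1),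
        C (2 ^ (m + 2 + 2) / ((m + 2).factorial : ℝ)) * quadPow a (m + 2) *
          derivative^[m + 2] g) =
      ∑ m ∈ Finset.range (g.natDegree + 1),
        C 4 * (C (2 ^ (m + 2) / ((m + 2).factorial : ℝ)) * quadPow (a + 1) (m + 2) *
          derivative^[m + 2] g) := by
    rw [← Finset.sum_add_distrib, ← Finset.sum_add_distrib]
    refine Finset.sum_congr rfl fun m _ => ?_
    rw [quadPow_add_one]
    refine funext fun x => ?_
    simp
    ring
  have h0 : C (2 ^ (0 + 2) / (Nat.factorial 0 : ℝ)) * quadPow a 0 * derivative^[0] g =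
      C 4 * (C (2 ^ 0 / (Nat.factorial 0 : ℝ)) * quadPow (a + 1) 0 * derivative^[0] g) := by
    simp only [quadPow_zero]
    refine funext fun x => ?_
    simp
    norm_num
  have h1 : C (2 ^ (0 + 3) / (Nat.factorial (0 + 1) : ℝ)) * quadPow a 0 * X * derivative^[0 + 1] g +
      C (2 ^ (1 + 2) / (Nat.factorial 1 : ℝ)) * quadPow a 1 * derivative^[1] g =
      C 4 * (C (2 ^ 1 / (Nat.factorial 1 : ℝ)) * quadPow (a + 1) 1 * derivative^[1] g) := by
    rw [quadPow_add_one_one]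
    refine funext fun x => ?_
    simp
    ring
  linear_combination hsum + h0 + h1

/-! ### The ultraspherical differential operator -/

/-- The ultraspherical operator `(x² - 1) f'' + 2 (a + 1) x f'`. -/
def ultraOp (a : ℝ) (f : ℝ[X]) : ℝ[X] :=
  (X ^ 2 - 1) * derivative (derivative f) + C (2 * (a + 1)) * X * derivative f

theorem coeff_ultraOp (a : ℝ) (f : ℝ[X]) (d : ℕ) :
    (ultraOp a f).coeff d =
      d * (d + 2 * a + 1) * f.coeff d - (d + 2) * (d + 1) * f.coeff (d + 2) := by
  rw [ultraOp, sub_mul, one_mul, mul_assoc, coeff_add, coeff_sub, coeff_C_mul, pow_two, mul_assoc]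
  match d with
  | 0 => simp [coeff_derivative]; ring
  | 1 => simp [coeff_X_mul, coeff_derivative]; ring
  | d + 2 => simp [coeff_X_mul, coeff_derivative]; ring

theorem ultraOp_eigen_eq_zero {a : ℝ} (ha : 0 ≤ a) {n : ℕ} {h : ℝ[X]} (hn : h.natDegree ≤ n)
    (hJ : ultraOp a h = C (n * (n + 2 * a + 1)) * h) (hc : h.coeff n = 0) : h = 0 := by
  by_contra h0
  have hd : h.natDegree < n := by
    refine lt_of_le_of_ne hn fun e => h0 ?_
    rw [← leadingCoeff_eq_zero, leadingCoeff, e, hc]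
  have h1 := congrArg (fun p => p.coeff h.natDegree) hJ
  simp only [coeff_ultraOp, coeff_C_mul] at h1
  rw [coeff_eq_zero_of_natDegree_lt (n := h.natDegree + 2) (by omega), mul_zero, sub_zero] at h1
  have h2 := mul_right_cancel₀ (by rwa [coeff_natDegree, Ne, leadingCoeff_eq_zero]) h1
  have h3 : (h.natDegree : ℝ) < n := by exact_mod_cast hd
  have h4 : (0 : ℝ) ≤ h.natDegree := by positivity
  nlinarith

theorem ultraOp_sub (a : ℝ) (f g : ℝ[X]) : ultraOp a (f - g) = ultraOp a f - ultraOp a g := by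
  simp only [ultraOp, derivative_sub]; ring

theorem ultraOp_C_mul (a c : ℝ) (f : ℝ[X]) : ultraOp a (C c * f) = C c * ultraOp a f := by
  simp only [ultraOp, derivative_C_mul]; ring

theorem ultraOp_sum {ι : Type*} (a : ℝ) (s : Finset ι) (f : ι → ℝ[X]) :
    ultraOp a (∑ i ∈ s, f i) = ∑ i ∈ s, ultraOp a (f i) := by
  simp only [ultraOp, derivative_sum, Finset.mul_sum, Finset.sum_add_distrib]

theorem natDegree_ultraOp_le (a : ℝ) (f : ℝ[X]) : (ultraOp a f).natDegree ≤ f.natDegree := by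
  refine natDegree_le_iff_coeff_eq_zero.2 fun N hN => ?_
  rw [coeff_ultraOp, coeff_eq_zero_of_natDegree_lt hN,
    coeff_eq_zero_of_natDegree_lt (n := N + 2) (by omega)]
  ring

theorem iterate_derivative_ultraOp (a : ℝ) (f : ℝ[X]) (m : ℕ) :
    derivative^[m] (ultraOp a f) = (X ^ 2 - 1) * derivative^[m + 2] f +
      C (2 * (m + a + 1)) * X * derivative^[m + 1] f +
      C (m * (m + 2 * a + 1)) * derivative^[m] f := by
  induction m with
  | zero =>
    rw [Function.iterate_zero_apply, ultraOp]
    simp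
  | succ m ih =>
    rw [Function.iterate_succ_apply', ih]
    simp only [derivative_add, derivative_mul, derivative_sub, derivative_X_pow, derivative_one,
      derivative_C, derivative_X, ← Function.iterate_succ_apply']
    refine funext fun x => ?_
    simp
    ring

theorem ultraOp_quadPow_succ (a : ℝ) (m : ℕ) :
    ultraOp a (quadPow a (m + 1)) - C ((m + 1) * (m + 2 * a + 2)) * quadPow a (m + 1) +
      C ((m : ℝ) + 1) * ((X ^ 2 - 1) * derivative (quadPow a m) - C (m : ℝ) * X * quadPow a m) =
      0 := by
  cases m with
  | zero =>
    rw [zero_add, quadPow_one, quadPow_zero, ultraOp]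
    refine funext fun x => ?_
    simp
    ring
  | succ m =>
    rw [ultraOp]
    simp only [derivative_quadPow_succ, derivative_C_mul]
    have h := quadPow_succ_succ a m
    refine funext fun x => ?_
    have h := congrArg (fun p => p.eval x) h
    simp at h ⊢
    linear_combination (-(m + 2 * a + 3)) * h

theorem quadOp_zero_ultraOp (a : ℝ) (f : ℝ[X]) :
    quadOp a 0 (ultraOp a f) = ultraOp a (quadOp a 0 f) := by
  rw [quadOp_eq_sum a 0 (Nat.lt_succ_of_le (natDegree_ultraOp_le a f)), quadOp, ultraOp_sum,
    ← sub_eq_zero, ← Finset.sum_sub_distrib]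
  simp only [add_zero]
  set P : ℕ → ℝ[X] := fun m => C (2 ^ m / (m.factorial : ℝ)) *
    (C (m * (m + 2 * a + 1)) * quadPow a m - ultraOp a (quadPow a m))
  set Q : ℕ → ℝ[X] := fun m => C (2 ^ m / (m.factorial : ℝ)) *
    (C (2 * (m : ℝ)) * X * quadPow a m - C 2 * (X ^ 2 - 1) * derivative (quadPow a m))
  have e : ∀ m, C (2 ^ m / (m.factorial : ℝ)) * quadPow a m * derivative^[m] (ultraOp a f) -
      ultraOp a (C (2 ^ m / (m.factorial : ℝ)) * quadPow a m * derivative^[m] f) =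
      P m * derivative^[m] f + Q m * derivative^[m + 1] f := by
    intro m
    rw [iterate_derivative_ultraOp]
    simp only [P, Q, ultraOp, derivative_mul, derivative_C, derivative_add,
      ← Function.iterate_succ_apply', zero_mul, zero_add]
    refine funext fun x => ?_
    simp
    ring
  simp only [e]
  have hP : P 0 = 0 := by simp [P, quadPow_zero, ultraOp]
  have hPQ : ∀ m, P (m + 1) + Q m = 0 := by
    intro m
    have h := ultraOp_quadPow_succ a m
    have h2 : (2 : ℝ) ^ m / (m.factorial : ℝ) =
        2 ^ (m + 1) / ((m + 1).factorial : ℝ) * ((m + 1) / 2) := by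
      rw [Nat.factorial_succ]
      have : (m.factorial : ℝ) ≠ 0 := by positivity
      push_cast
      field_simp
      ring
    simp only [P, Q]
    rw [h2]
    refine funext fun x => ?_
    have h := congrArg (fun p => p.eval x) h
    simp at h ⊢
    linear_combination (-(2 ^ (m + 1) / ((m + 1).factorial : ℝ))) * h
  rw [Finset.sum_add_distrib, Finset.sum_range_succ', Finset.sum_range_succ (n := f.natDegree),
    hP, iterate_derivative_eq_zero (x := f.natDegree + 1) (by omega), zero_mul, mul_zero,
    add_zero, add_zero, ← Finset.sum_add_distrib]
  refine Finset.sum_eq_zero fun m _ => ?_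
  rw [← add_mul, hPQ, zero_mul]

theorem natDegree_quadOp_zero_le (a : ℝ) (f : ℝ[X]) :
    (quadOp a 0 f).natDegree ≤ f.natDegree := by
  refine natDegree_sum_le_of_forall_le _ _ fun m hm => ?_
  have h1 := natDegree_quadPow_le a m
  have h2 := natDegree_iterate_derivative f m
  have h3 := Finset.mem_range.1 hm
  rw [mul_assoc]
  refine (natDegree_C_mul_le _ _).trans (natDegree_mul_le.trans ?_)
  rw [add_zero]
  omega

theorem coeff_quadOp_zero (a : ℝ) {f : ℝ[X]} {n : ℕ} (hf : f.natDegree ≤ n) :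
    (quadOp a 0 f).coeff n = Ring.choose (n + 2 * a) n * f.coeff n := by
  rw [quadOp_eq_sum a 0 (Nat.lt_succ_of_le hf), finsetSum_coeff, Ring.add_choose_eq_sum_range,
    ← Finset.sum_range_reflect (fun i => Ring.choose (n : ℝ) i * Ring.choose (2 * a) (n - i)),
    Finset.sum_mul]
  refine Finset.sum_congr rfl fun m hm => ?_
  have hm : m ≤ n := Nat.lt_succ_iff.1 (Finset.mem_range.1 hm)
  have h1 := natDegree_quadPow_le a m
  have h2 : (derivative^[m] f).natDegree ≤ n - m :=
    (natDegree_iterate_derivative f m).trans (by omega)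
  have h3 := coeff_mul_add_eq_of_natDegree_le h1 h2
  rw [show m + (n - m) = n by omega] at h3
  rw [add_zero, mul_assoc, coeff_C_mul, h3, coeff_quadPow_self, coeff_iterate_derivative,
    Nat.sub_add_cancel hm, show n + 1 - 1 - m = n - m by omega, show n - (n - m) = m by omega,
    Ring.choose_natCast, Nat.choose_symm hm, Nat.descFactorial_eq_factorial_mul_choose]
  have : (m.factorial : ℝ) ≠ 0 := by positivity
  simp only [nsmul_eq_mul]
  push_cast
  field_simp

theorem quadOp_zero_eigen {a : ℝ} (ha : 0 ≤ a) {n : ℕ} {f : ℝ[X]} (hf : f.natDegree ≤ n)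
    (hJ : ultraOp a f = C (n * (n + 2 * a + 1)) * f) :
    quadOp a 0 f = C (Ring.choose (n + 2 * a) n) * f := by
  rw [← sub_eq_zero]
  refine ultraOp_eigen_eq_zero ha (n := n) ?_ ?_ ?_
  · exact (natDegree_sub_le _ _).trans (max_le ((natDegree_quadOp_zero_le a f).trans hf)
      ((natDegree_C_mul_le _ _).trans hf))
  · rw [ultraOp_sub, ultraOp_C_mul, ← quadOp_zero_ultraOp, hJ, quadOp_C_mul]
    ring
  · rw [coeff_sub, coeff_quadOp_zero a hf, coeff_C_mul, sub_self]

theorem Ring.sub_mul_choose_add_one (z : ℝ) (k : ℕ) :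
    (z + 1 - k) * Ring.choose (z + 1) k = (z + 1) * Ring.choose z k := by
  rw [← Ring.succ_mul_choose_succ, Ring.succ_mul_choose_succ', add_sub_cancel_right]

theorem choose_add_two_mul (a : ℝ) (k : ℕ) :
    (2 * a + 1) * (2 * a + 2) * Ring.choose (k + 2 * (a + 1)) k =
      (k + 2 * a + 1) * (k + 2 * a + 2) * Ring.choose (k + 2 * a) k := by
  have h1 := Ring.sub_mul_choose_add_one (k + 2 * a) k
  have h2 := Ring.sub_mul_choose_add_one (k + 2 * a + 1) k
  rw [show (k : ℝ) + 2 * (a + 1) = k + 2 * a + 1 + 1 by ring]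
  linear_combination (2 * a + 1) * h2 + (k + 2 * a + 2) * h1

theorem choose_add_two_succ_succ (a : ℝ) (k : ℕ) :
    ((k : ℝ) + 1) * (k + 2) * Ring.choose (((k + 2 : ℕ) : ℝ) + 2 * a) (k + 2) =
      (k + 2 * a + 1) * (k + 2 * a + 2) * Ring.choose (k + 2 * a) k := by
  have h1 := Ring.succ_mul_choose_succ' (k + 2 * a + 1) k
  have h2 := Ring.succ_mul_choose_succ' (k + 2 * a + 2) (k + 1)
  rw [show (k : ℝ) + 2 * a + 1 - 1 = k + 2 * a by ring] at h1
  rw [show (k : ℝ) + 2 * a + 2 - 1 = k + 2 * a + 1 by ring] at h2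
  rw [show ((k + 2 : ℕ) : ℝ) + 2 * a = k + 2 * a + 2 by push_cast; ring]
  push_cast at h2
  linear_combination ((k : ℝ) + 1) * h2 + (k + 2 * a + 2) * h1

theorem ultraOp_derivative {b μ : ℝ} {f : ℝ[X]} (h : ultraOp b f = C μ * f) :
    ultraOp (b + 1) (derivative f) = C (μ - 2 * (b + 1)) * derivative f := by
  have h := congrArg derivative h
  rw [ultraOp] at *
  simp only [derivative_add, derivative_mul, derivative_sub, derivative_X_pow, derivative_one,
      derivative_C, derivative_X] at h
  refine funext fun x => ?_
  have h := congrArg (fun p => p.eval x) h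
  simp at h ⊢
  linear_combination h

/-- If `f` is the ultraspherical polynomial of degree `k + 2` with parameter `a - 1`, then
`(x² - 1) f''` is an eigenfunction of `(x² - 1) quadOp a 2`. -/
theorem quadOp_two_X_sq_sub_one_mul_derivative {a : ℝ} (ha : 0 < a) {k : ℕ} {f : ℝ[X]}
    (hf : f.natDegree ≤ k + 2)
    (hJ : ultraOp (a - 1) f = C ((k + 2) * (k + 2 * a + 1)) * f) :
    quadOp a 2 ((X ^ 2 - 1) * derivative (derivative f)) =
      C (4 * Ring.choose (k + 2 * (a + 1)) k) * derivative (derivative f) := by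
  have h1 := ultraOp_derivative (ultraOp_derivative hJ)
  have h2 : (derivative (derivative f)).natDegree ≤ k := by
    have e1 := natDegree_derivative_le (derivative f)
    have e2 := natDegree_derivative_le f
    omega
  rw [quadOp_two_X_sq_sub_one_mul, C_mul, mul_assoc]
  congr 1
  refine quadOp_zero_eigen (by linarith) h2 ?_
  convert h1 using 2
  · ring
  · congr 1; ring

theorem X_mul_derivative_add_eigen {a ν : ℝ} {f : ℝ[X]}
    (hJ : ultraOp (a - 1) f = C (ν * (ν + 2 * a - 1)) * f) :
    ultraOp a (X * derivative f + C (ν + 2 * a - 1) * f) =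
      C (ν * (ν + 2 * a + 1)) * (X * derivative f + C (ν + 2 * a - 1) * f) := by
  have h' := congrArg derivative hJ
  rw [ultraOp] at *
  simp only [derivative_add, derivative_mul, derivative_sub, derivative_X_pow, derivative_one,
      derivative_C, derivative_X] at h' ⊢
  refine funext fun x => ?_
  have h := congrArg (fun p => p.eval x) hJ
  have h' := congrArg (fun p => p.eval x) h'
  simp at h h' ⊢
  linear_combination x * h' + (ν + 2 * a + 1) * h

theorem X_mul_derivative_sub_eigen {a ν : ℝ} {f : ℝ[X]}
    (hJ : ultraOp (a - 1) f = C (ν * (ν + 2 * a - 1)) * f) :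
    ultraOp a (X * derivative f - C ν * f) =
      C ((ν - 2) * (ν + 2 * a - 1)) * (X * derivative f - C ν * f) := by
  have h' := congrArg derivative hJ
  rw [ultraOp] at *
  simp only [derivative_add, derivative_mul, derivative_sub, derivative_X_pow, derivative_one,
      derivative_C, derivative_X] at h' ⊢
  refine funext fun x => ?_
  have h := congrArg (fun p => p.eval x) hJ
  have h' := congrArg (fun p => p.eval x) h'
  simp at h h' ⊢
  linear_combination x * h' + (2 - ν) * h

theorem natDegree_X_mul_derivative_sub_le {a : ℝ} (ha : 0 < a) {k : ℕ} {f : ℝ[X]}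
    (hf : f.natDegree ≤ k + 2)
    (hJ : ultraOp (a - 1) f = C ((k + 2) * (k + 2 * a + 1)) * f) :
    (X * derivative f - C ((k : ℝ) + 2) * f).natDegree ≤ k := by
  have hc : ∀ N, (X * derivative f - C ((k : ℝ) + 2) * f).coeff N =
      (N - (k + 2)) * f.coeff N := by
    intro N
    cases N with
    | zero => rw [coeff_sub, coeff_C_mul, coeff_X_mul_zero]; push_cast; ring
    | succ N =>
      rw [coeff_sub, coeff_C_mul, coeff_X_mul, coeff_derivative]; push_cast; ring
  refine natDegree_le_iff_coeff_eq_zero.2 fun N hN => ?_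
  rw [hc]
  rcases Nat.lt_or_ge (k + 2) N with h | h
  · rw [coeff_eq_zero_of_natDegree_lt (by omega), mul_zero]
  rcases Nat.lt_or_ge (k + 1) N with h2 | h2
  · obtain rfl : N = k + 2 := by omega
    push_cast
    ring
  · obtain rfl : N = k + 1 := by omega
    have h3 := congrArg (fun p => p.coeff (k + 1)) hJ
    simp only [coeff_ultraOp, coeff_C_mul] at h3
    rw [coeff_eq_zero_of_natDegree_lt (n := k + 1 + 2) (by omega)] at h3
    have h4 : (2 * k + 2 * a + 2) * f.coeff (k + 1) = 0 := by
      push_cast at h3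
      linear_combination -h3
    rcases mul_eq_zero.1 h4 with h5 | h5
    · exfalso
      have : (0 : ℝ) ≤ k := by positivity
      linarith
    · rw [h5, mul_zero]

theorem quadOp_zero_of_ultraOp_sub_one {a : ℝ} (ha : 0 < a) {k : ℕ} {f : ℝ[X]}
    (hf : f.natDegree ≤ k + 2)
    (hJ : ultraOp (a - 1) f = C ((k + 2) * (k + 2 * a + 1)) * f) :
    quadOp a 0 f = C (Ring.choose (k + 2 * a) k / ((k + 1) * (k + 2))) *
      (C (2 * a) * (X * derivative f) +
        C ((k + 1) * (k + 2) + 2 * a * (k + 1) + 4 * a ^ 2) * f) := by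
  have hJ' : ultraOp (a - 1) f = C (((k : ℝ) + 2) * ((k + 2) + 2 * a - 1)) * f := by
    rw [hJ]; congr 2; ring
  have e1 := X_mul_derivative_add_eigen hJ'
  have e2 := X_mul_derivative_sub_eigen hJ'
  have d2 := natDegree_X_mul_derivative_sub_le ha hf hJ
  have d1 : (X * derivative f + C ((k : ℝ) + 2 + 2 * a - 1) * f).natDegree ≤ k + 2 := by
    refine (natDegree_add_le _ _).trans (max_le ?_ ((natDegree_C_mul_le _ _).trans hf))
    refine natDegree_le_iff_coeff_eq_zero.2 fun N hN => ?_
    obtain ⟨N, rfl⟩ : ∃ N', N = N' + 1 := ⟨N - 1, by omega⟩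
    rw [coeff_X_mul, coeff_derivative, coeff_eq_zero_of_natDegree_lt (by omega), zero_mul]
  have r1 := quadOp_zero_eigen ha.le (n := k + 2) d1 (by rw [e1]; push_cast; rfl)
  have r2 := quadOp_zero_eigen ha.le (n := k) d2 (by rw [e2]; congr 2; ring)
  have hk : (k : ℝ) + 1 ≠ 0 := by positivity
  have hk2 : (k : ℝ) + 2 ≠ 0 := by positivity
  have hs : 2 * (k : ℝ) + 3 + 2 * a ≠ 0 := by positivity
  have h1 := choose_add_two_succ_succ a k
  set ρ := Ring.choose (k + 2 * a) k
  have h2 : Ring.choose (((k + 2 : ℕ) : ℝ) + 2 * a) (k + 2) =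
      (k + 2 * a + 1) * (k + 2 * a + 2) * (ρ / ((k + 1) * (k + 2))) := by
    field_simp
    linear_combination h1
  have h3 : ρ = (k + 1) * (k + 2) * (ρ / ((k + 1) * (k + 2))) := by field_simp
  rw [h2] at r1
  rw [h3] at r2
  set σ := ρ / ((k + 1) * (k + 2))
  rw [quadOp_add, quadOp_C_mul] at r1
  rw [quadOp_sub, quadOp_C_mul] at r2
  refine funext fun x => ?_
  apply mul_left_cancel₀ hs
  have r1 := congrArg (fun p => p.eval x) r1
  have r2 := congrArg (fun p => p.eval x) r2
  simp at r1 r2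
  simp only [eval_add, eval_mul, eval_C, eval_X]
  linear_combination r1 - r2

theorem one_sub_X_sq_mul_quadOp_two {a : ℝ} (ha : 0 < a) {k : ℕ} {f : ℝ[X]}
    (hf : f.natDegree ≤ k + 2)
    (hJ : ultraOp (a - 1) f = C ((k + 2) * (k + 2 * a + 1)) * f) :
    C ((2 * a + 1) * (a + 1)) * (1 - X ^ 2) * quadOp a 2 f =
      C (2 * (Ring.choose (k + 2 * a) k / ((k + 1) * (k + 2)))) *
        (C (4 * a * (a + 1)) * derivative (derivative f) -
          C ((k + 1) * (k + 2) * (k + 2 * a + 1) * (k + 2 * a + 2)) * f) := by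
  have h := quadOp_zero_of_ultraOp_sub_one ha hf hJ
  have d := derivative_quadOp a 0 f
  have d2 := congrArg derivative d
  rw [derivative_C_mul, derivative_quadOp a (0 + 1), h] at d2
  have h' := congrArg derivative hJ
  rw [ultraOp] at hJ h'
  simp only [derivative_add, derivative_mul, derivative_sub, derivative_X_pow, derivative_one,
      derivative_C, derivative_X] at h' d2
  refine funext fun x => ?_
  have h1 := congrArg (fun p => p.eval x) hJ
  have h2 := congrArg (fun p => p.eval x) h'
  have h3 := congrArg (fun p => p.eval x) d2
  simp at h1 h2 h3 ⊢
  set σ := Ring.choose (k + 2 * a) k / ((k + 1) * (k + 2))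
  set f0 := eval x f
  set f1 := eval x (derivative f)
  set f2 := eval x (derivative (derivative f))
  set f3 := eval x (derivative (derivative (derivative f)))
  linear_combination (-2 * (1 - x ^ 2)) * h3 - 2 * σ * (2 * a) * x * h2 -
    2 * σ * ((k + 1) * (k + 2) + 2 * a * (k + 1)) * h1

/-- If `f` is the ultraspherical polynomial of degree `k + 2` with parameter `a - 1`, then
`f + 2 M σ (x² - 1) f''` solves the differential equation with the perturbation
`(2 a + 1) (1 - x²) quadOp a 2`. -/
theorem perturbed_ultraspherical_equation {a : ℝ} (ha : 0 < a) {k : ℕ} {f : ℝ[X]}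
    (hf : f.natDegree ≤ k + 2)
    (hJ : ultraOp (a - 1) f = C ((k + 2) * (k + 2 * a + 1)) * f) (M : ℝ) {Y : ℝ[X]}
    (hY : Y = f + C (2 * M * (Ring.choose (k + 2 * a) k / ((k + 1) * (k + 2)))) *
      ((X ^ 2 - 1) * derivative (derivative f))) :
    C M * (C (2 * a + 1) * (1 - X ^ 2) * quadOp a 2 Y +
      C (4 * (2 * a + 1) * Ring.choose (k + 2 * (a + 1)) k) * Y) -
      ultraOp (a - 1) Y + C ((k + 2) * (k + 2 * a + 1)) * Y = 0 := by
  have e1 := quadOp_two_X_sq_sub_one_mul_derivative ha hf hJ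
  have e2 := one_sub_X_sq_mul_quadOp_two ha hf hJ
  have e3 := choose_add_two_mul a k
  have hk : (k : ℝ) + 1 ≠ 0 := by positivity
  have hk2 : (k : ℝ) + 2 ≠ 0 := by positivity
  have h3 : Ring.choose (k + 2 * a) k =
    (k + 1) * (k + 2) * (Ring.choose (k + 2 * a) k / ((k + 1) * (k + 2))) := by field_simp
  set σ := Ring.choose (k + 2 * a) k / ((k + 1) * (k + 2))
  rw [h3] at e3
  rw [hY, quadOp_add, quadOp_C_mul, e1]
  have h' := congrArg derivative hJ
  have h'' := congrArg derivative h'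
  rw [ultraOp] at hJ h' h'' ⊢
  simp only [derivative_add, derivative_mul, derivative_sub, derivative_X_pow, derivative_one,
      derivative_C, derivative_X] at h' h'' ⊢
  refine funext fun x => ?_
  have ha1 : a + 1 ≠ 0 := by positivity
  apply mul_left_cancel₀ ha1
  have h0 := congrArg (fun p => p.eval x) hJ
  have h2 := congrArg (fun p => p.eval x) h''
  have e2 := congrArg (fun p => p.eval x) e2
  simp at h0 h2 e2
  simp only [eval_add, eval_mul, eval_C, eval_X, eval_sub, eval_pow, eval_one, eval_zero,
    derivative_zero]
  set τ := Ring.choose (k + 2 * (a + 1)) k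
  set f0 := eval x f
  set f2 := eval x (derivative (derivative f))
  set f4 := eval x (derivative (derivative (derivative (derivative f))))
  linear_combination M * e2 - (a + 1) * h0 + 2 * M * f0 * e3 -
    (a + 1) * 2 * M * σ * (x ^ 2 - 1) * h2

/-! ### Even and odd polynomials -/

theorem Polynomial.coeff_comp_neg_X (p : ℝ[X]) (n : ℕ) :
    (p.comp (-X)).coeff n = (-1) ^ n * p.coeff n := by
  rw [show (-X : ℝ[X]) = C (-1) * X by simp, comp_C_mul_X_coeff, mul_comm]

theorem Polynomial.exists_eq_comp_of_even {p : ℝ[X]} {j : ℕ} (hp : p.comp (-X) = p)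
    (hd : p.natDegree ≤ 2 * j) :
    ∃ δ : ℝ[X], δ.natDegree ≤ j ∧ p = δ.comp (2 * X ^ 2 - 1) := by
  refine ⟨(∑ k ∈ Finset.range (j + 1), C (p.coeff (2 * k)) * X ^ k).comp (C (1 / 2) * (X + 1)),
    ?_, ?_⟩
  · refine natDegree_comp_le.trans ?_
    have h1 : (∑ k ∈ Finset.range (j + 1), C (p.coeff (2 * k)) * X ^ k : ℝ[X]).natDegree ≤ j :=
      natDegree_sum_le_of_forall_le _ _ fun k hk =>
        (natDegree_C_mul_X_pow_le _ _).trans (Nat.lt_succ_iff.1 (Finset.mem_range.1 hk))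
    have h2 : (C (1 / 2) * (X + 1) : ℝ[X]).natDegree ≤ 1 := by compute_degree
    nlinarith
  · have e : (C (1 / 2) * (X + 1) : ℝ[X]).comp (2 * X ^ 2 - 1) = X ^ 2 := by
      refine funext fun x => ?_
      simp
    rw [comp_assoc, e]
    ext i
    simp only [Polynomial.sum_comp, mul_comp, C_comp, pow_comp, X_comp, ← pow_mul, finsetSum_coeff,
      coeff_C_mul_X_pow]
    rcases Nat.even_or_odd' i with ⟨k, rfl | rfl⟩
    · by_cases hk : k < j + 1
      · rw [Finset.sum_eq_single k]
        · simp
        · intro b _ hb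
          rw [if_neg (by omega)]
        · intro h
          exact absurd (Finset.mem_range.2 hk) h
      · rw [coeff_eq_zero_of_natDegree_lt (by omega), Finset.sum_eq_zero]
        intro b hb
        rw [if_neg]
        have := Finset.mem_range.1 hb
        omega
    · rw [Finset.sum_eq_zero fun b _ => if_neg (by omega)]
      have h := congrArg (fun q => q.coeff (2 * k + 1)) hp
      simp only [coeff_comp_neg_X] at h
      rw [Odd.neg_one_pow ⟨k, rfl⟩] at h
      linarith

theorem Polynomial.exists_eq_X_mul_comp_of_odd {p : ℝ[X]} {j : ℕ} (hp : p.comp (-X) = -p)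
    (hd : p.natDegree ≤ 2 * j + 1) :
    ∃ δ : ℝ[X], δ.natDegree ≤ j ∧ p = X * δ.comp (2 * X ^ 2 - 1) := by
  have h0 : p.coeff 0 = 0 := by
    have h := congrArg (fun q => q.coeff 0) hp
    simp only [coeff_comp_neg_X, coeff_neg] at h
    simp at h
    linarith
  have h1 : p = X * p.divX := by
    conv_lhs => rw [← divX_mul_X_add p, h0, C_0, add_zero, mul_comm]
  have h2 : p.divX.comp (-X) = p.divX := by
    have h := hp
    rw [h1, mul_comp, X_comp, neg_mul, neg_inj] at h
    rw [← h1] at h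
    exact mul_left_cancel₀ X_ne_zero (h.trans h1)
  obtain ⟨δ, hδ, e⟩ := exists_eq_comp_of_even h2 (j := j)
    (by rw [natDegree_divX_eq_natDegree_tsub_one]; omega)
  exact ⟨δ, hδ, by rw [← e, ← h1]⟩

theorem Polynomial.exists_derivative_eq (f : ℝ[X]) :
    ∃ F : ℝ[X], derivative F = f ∧ F.natDegree ≤ f.natDegree + 1 := by
  refine ⟨∑ k ∈ Finset.range (f.natDegree + 1), C (f.coeff k / (k + 1)) * X ^ (k + 1), ?_, ?_⟩
  · conv_rhs => rw [f.as_sum_range_C_mul_X_pow]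
    rw [derivative_sum]
    refine Finset.sum_congr rfl fun k _ => ?_
    rw [derivative_C_mul_X_pow]
    have : (k : ℝ) + 1 ≠ 0 := by positivity
    push_cast
    rw [div_mul_cancel₀ _ this]
  · refine natDegree_sum_le_of_forall_le _ _ fun k hk => (natDegree_C_mul_X_pow_le _ _).trans ?_
    have := Finset.mem_range.1 hk
    omega

/-! ### Higher derivatives of `y (2 x² - 1)` -/

theorem eval_iterate_derivative_comp (y : ℝ[X]) {J : ℕ} (hJ : y.natDegree < J) (i : ℕ) (x : ℝ) :
    (derivative^[i] (y.comp (2 * X ^ 2 - 1))).eval x =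
      ∑ j ∈ Finset.range J, (if j ≤ i then (i.factorial : ℝ) / (j.factorial : ℝ) *
        2 ^ (3 * j - i) * x ^ (2 * j - i) * (j.choose (i - j) : ℝ) else 0) *
        (derivative^[j] y).eval (2 * x ^ 2 - 1) := by
  have h1 : taylor x (y.comp (2 * X ^ 2 - 1)) =
      (taylor (2 * x ^ 2 - 1) y).comp (X * (C 2 * (X + C (2 * x)))) := by
    rw [taylor_apply, taylor_apply, comp_assoc, comp_assoc]
    congr 1
    refine funext fun z => ?_
    simp
    ring
  have h2 := congrArg (fun p => p.coeff i) h1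
  simp only [taylor_coeff] at h2
  have hnd : (taylor (2 * x ^ 2 - 1) y).natDegree < J := by rwa [natDegree_taylor]
  have hh : ∀ (p : ℝ[X]) (k : ℕ) (z : ℝ), (derivative^[k] p).eval z =
      (k.factorial : ℝ) * (hasseDeriv k p).eval z := by
    intro p k z
    have h := congrFun (factorial_smul_hasseDeriv (R := ℝ) k) p
    rw [← h]
    simp
  rw [hh, h2, (taylor (2 * x ^ 2 - 1) y).as_sum_range' J hnd, Polynomial.sum_comp, finsetSum_coeff,
    Finset.mul_sum]
  refine Finset.sum_congr rfl fun j _ => ?_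
  rw [taylor_coeff, hh, monomial_comp, mul_pow, mul_pow, ← C_pow, coeff_C_mul, coeff_X_pow_mul']
  split_ifs with hji
  · rw [coeff_C_mul, coeff_X_add_C_pow]
    rcases Nat.lt_or_ge (2 * j) i with h | h
    · rw [Nat.choose_eq_zero_of_lt (by omega)]
      simp
    · rw [show j - (i - j) = 2 * j - i by omega, show 3 * j - i = j + (2 * j - i) by omega,
        pow_add, mul_pow]
      have : (j.factorial : ℝ) ≠ 0 := by positivity
      field_simp
  · simp

theorem eval_iterate_derivative_X_mul_comp (y : ℝ[X]) {J : ℕ} (hJ : y.natDegree < J) (i : ℕ)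
    (x : ℝ) :
    (derivative^[i] (X * y.comp (2 * X ^ 2 - 1))).eval x =
      ∑ j ∈ Finset.range J, (if j ≤ i then ((i + 1).factorial : ℝ) / ((j + 1).factorial : ℝ) *
        (2 ^ (3 * j + 2 - i) / 4) * x ^ (2 * j + 1 - i) * ((j + 1).choose (i - j) : ℝ) else 0) *
        (derivative^[j] y).eval (2 * x ^ 2 - 1) := by
  obtain ⟨z, hz, hzd⟩ := exists_derivative_eq y
  have hzc : derivative (z.comp (2 * X ^ 2 - 1)) = C 4 * (X * y.comp (2 * X ^ 2 - 1)) := by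
    rw [derivative_comp, hz]
    refine funext fun x => ?_
    simp
    ring
  have hi : (derivative^[i] (X * y.comp (2 * X ^ 2 - 1))).eval x = 1 / 4 *
      (derivative^[i + 1] (z.comp (2 * X ^ 2 - 1))).eval x := by
    rw [Function.iterate_succ_apply, hzc, iterate_derivative_C_mul, eval_mul, eval_C]
    ring
  rw [hi, eval_iterate_derivative_comp z (show z.natDegree < J + 1 by omega),
    Finset.sum_range_succ', Nat.choose_eq_zero_of_lt (by omega : 0 < i + 1 - 0)]
  simp only [Nat.cast_zero, mul_zero, ite_self, zero_mul, add_zero]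
  rw [Finset.mul_sum]
  refine Finset.sum_congr rfl fun j _ => ?_
  rw [Function.iterate_succ_apply, hz]
  simp only [Nat.add_le_add_iff_right, Nat.add_sub_add_right]
  split_ifs with h
  · rw [show 3 * (j + 1) - (i + 1) = 3 * j + 2 - i by omega,
      show 2 * (j + 1) - (i + 1) = 2 * j + 1 - i by omega]
    ring
  · ring

/-! ### The coefficients as polynomials -/

/-- The polynomial with values `cCoeff α i x`, `i ≥ 1`. -/
def cPoly (α : ℝ) : ℕ → ℝ[X]
  | 0 => 0
  | 1 => 0
  | m + 2 => C ((2 * α + 3) * (2 ^ (m + 2) / ((m + 2).factorial : ℝ))) * (1 - X ^ 2) *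
      quadPow (α + 1) m

theorem binom_natCast (x : ℝ) (k : ℕ) : binom x k = Ring.choose x k := by
  simp [binom]

theorem eval_cPoly (α : ℝ) {i : ℕ} (hi : 1 ≤ i) (x : ℝ) :
    (cPoly α i).eval x = cCoeff α i x := by
  match i, hi with
  | 1, _ => simp [cPoly, cCoeff]
  | m + 2, _ =>
    rw [cPoly, cCoeff, quadPow]
    simp only [eval_mul, eval_C, eval_sub, eval_one, eval_pow, eval_X, eval_finsetSum]
    rw [show m + 2 - 1 = m + 1 by omega]
    have : ∀ k ∈ Finset.range (m + 1), binom (α + 1) (((m + 2 : ℕ) : ℤ) - k - 2) *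
        binom (((m + 2 : ℕ) : ℝ) - 2 * α - 5) k * ((1 - x) / 2) ^ k =
        Ring.choose (α + 1) (m - k) * Ring.choose (m - 2 * (α + 1) - 1) k *
          (1 / 2 * (1 - x)) ^ k := by
      intro k hk
      have hk := Finset.mem_range.1 hk
      rw [show ((m + 2 : ℕ) : ℤ) - k - 2 = ((m - k : ℕ) : ℤ) by omega, binom_natCast,
        binom_natCast]
      congr 2
      · congr 1; push_cast; ring
      · ring
    rw [Finset.sum_congr rfl this]
    ring

theorem natDegree_cPoly_le (α : ℝ) (i : ℕ) : (cPoly α i).natDegree ≤ i := by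
  match i with
  | 0 => simp [cPoly]
  | 1 => simp [cPoly]
  | m + 2 =>
    rw [cPoly, mul_assoc]
    refine (natDegree_C_mul_le _ _).trans (natDegree_mul_le.trans ?_)
    have h1 : (1 - X ^ 2 : ℝ[X]).natDegree ≤ 2 := by compute_degree
    have h2 := natDegree_quadPow_le (α + 1) m
    omega

theorem cPoly_comp_neg_X (α : ℝ) (i : ℕ) : (cPoly α i).comp (-X) = (-1) ^ i * cPoly α i := by
  match i with
  | 0 => simp [cPoly]
  | 1 => simp [cPoly]
  | m + 2 =>
    rw [cPoly]
    simp only [mul_comp, C_comp, sub_comp, one_comp, pow_comp, X_comp, quadPow_comp_neg_X]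
    ring

theorem sum_cPoly_mul (α : ℝ) {f : ℝ[X]} {K : ℕ} (hK : f.natDegree < K) :
    ∑ i ∈ Finset.range K, cPoly α i * derivative^[i] f =
      C (2 * α + 3) * (1 - X ^ 2) * quadOp (α + 1) 2 f := by
  have h : ∑ i ∈ Finset.range K, cPoly α i * derivative^[i] f =
      ∑ i ∈ Finset.range (K + 2), cPoly α i * derivative^[i] f := by
    refine Finset.sum_subset (Finset.range_subset_range.2 (by omega)) fun m _ hm => ?_
    rw [Finset.mem_range] at hm
    rw [iterate_derivative_eq_zero (by omega), mul_zero]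
  rw [h, Finset.sum_range_succ', Finset.sum_range_succ', quadOp_eq_sum _ _ hK, Finset.mul_sum]
  simp only [cPoly, zero_mul, add_zero]
  exact Finset.sum_congr rfl fun m _ => by rw [C_mul]; ring

/-- The polynomial with values `dCoeff α j x`, `j ≥ 1`. -/
def dPoly (α : ℝ) (j : ℕ) : ℝ[X] :=
  ∑ i ∈ Finset.Icc j (2 * j), C (((i.factorial : ℝ) * 2 ^ (3 * j - i)) /
      (((2 * j - i).factorial : ℝ) * ((i - j).factorial : ℝ))) * X ^ (2 * j - i) * cPoly α i

/-- The polynomial with values `x * eCoeff α j x`, `j ≥ 1`. -/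
def xePoly (α : ℝ) (j : ℕ) : ℝ[X] :=
  ∑ i ∈ Finset.Icc j (2 * j + 1), C ((((i + 1).factorial : ℝ) * 2 ^ (3 * j - i)) /
      (((2 * j + 1 - i).factorial : ℝ) * ((i - j).factorial : ℝ))) * X ^ (2 * j + 1 - i) *
      cPoly α i

theorem eval_dPoly (α : ℝ) {j : ℕ} (hj : 1 ≤ j) (x : ℝ) :
    (dPoly α j).eval x = dCoeff α j x := by
  rw [dPoly, dCoeff, eval_finsetSum]
  refine Finset.sum_congr rfl fun i hi => ?_
  rw [eval_mul, eval_mul, eval_C, eval_X_pow, eval_cPoly α (hj.trans (Finset.mem_Icc.1 hi).1)]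

theorem eval_xePoly (α : ℝ) {j : ℕ} (hj : 1 ≤ j) {x : ℝ} (hx : x ≠ 0) :
    (xePoly α j).eval x = x * eCoeff α j x := by
  rw [xePoly, eCoeff, eval_finsetSum, Finset.mul_sum]
  refine Finset.sum_congr rfl fun i hi => ?_
  have hi := Finset.mem_Icc.1 hi
  rw [eval_mul, eval_mul, eval_C, eval_X_pow, eval_cPoly α (hj.trans hi.1)]
  have : x ^ (2 * j + 1 - i) = x * x ^ (2 * (j : ℤ) - (i : ℤ)) := by
    rw [← zpow_natCast, ← zpow_one_add₀ hx]
    congr 1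
    omega
  rw [this]
  ring

theorem dPoly_comp_neg_X (α : ℝ) (j : ℕ) : (dPoly α j).comp (-X) = dPoly α j := by
  rw [dPoly, Polynomial.sum_comp]
  refine Finset.sum_congr rfl fun i hi => ?_
  have hi := Finset.mem_Icc.1 hi
  rw [mul_comp, mul_comp, C_comp, pow_comp, X_comp, cPoly_comp_neg_X, neg_pow]
  have : ((-1) ^ (2 * j - i) * (-1) ^ i : ℝ[X]) = 1 := by
    rw [← pow_add, show 2 * j - i + i = 2 * j by omega, pow_mul]
    simp
  linear_combination (C ((i.factorial : ℝ) * 2 ^ (3 * j - i) /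
    (((2 * j - i).factorial : ℝ) * ((i - j).factorial : ℝ))) * X ^ (2 * j - i) * cPoly α i) * this

theorem xePoly_comp_neg_X (α : ℝ) (j : ℕ) : (xePoly α j).comp (-X) = -xePoly α j := by
  rw [xePoly, Polynomial.sum_comp, ← Finset.sum_neg_distrib]
  refine Finset.sum_congr rfl fun i hi => ?_
  have hi := Finset.mem_Icc.1 hi
  rw [mul_comp, mul_comp, C_comp, pow_comp, X_comp, cPoly_comp_neg_X, neg_pow]
  have : ((-1) ^ (2 * j + 1 - i) * (-1) ^ i : ℝ[X]) = -1 := by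
    rw [← pow_add, show 2 * j + 1 - i + i = 2 * j + 1 by omega, pow_succ, pow_mul]
    simp
  linear_combination (C (((i + 1).factorial : ℝ) * 2 ^ (3 * j - i) /
    (((2 * j + 1 - i).factorial : ℝ) * ((i - j).factorial : ℝ))) * X ^ (2 * j + 1 - i) *
    cPoly α i) * this

theorem natDegree_dPoly_le (α : ℝ) (j : ℕ) : (dPoly α j).natDegree ≤ 2 * j := by
  refine natDegree_sum_le_of_forall_le _ _ fun i hi => ?_
  have hi := Finset.mem_Icc.1 hi
  have h1 := natDegree_cPoly_le α i
  refine natDegree_mul_le.trans ?_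
  have h2 := natDegree_C_mul_X_pow_le (((i.factorial : ℝ) * 2 ^ (3 * j - i)) /
      (((2 * j - i).factorial : ℝ) * ((i - j).factorial : ℝ))) (2 * j - i)
  omega

theorem natDegree_xePoly_le (α : ℝ) (j : ℕ) : (xePoly α j).natDegree ≤ 2 * j + 1 := by
  refine natDegree_sum_le_of_forall_le _ _ fun i hi => ?_
  have hi := Finset.mem_Icc.1 hi
  have h1 := natDegree_cPoly_le α i
  refine natDegree_mul_le.trans ?_
  have h2 := natDegree_C_mul_X_pow_le ((((i + 1).factorial : ℝ) * 2 ^ (3 * j - i)) /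
      (((2 * j + 1 - i).factorial : ℝ) * ((i - j).factorial : ℝ))) (2 * j + 1 - i)
  omega

theorem sum_dPoly_mul (α : ℝ) (y : ℝ[X]) {J : ℕ} (hJ : y.natDegree < J) (x : ℝ) :
    ∑ j ∈ Finset.range J, (dPoly α j).eval x * (derivative^[j] y).eval (2 * x ^ 2 - 1) =
      (2 * α + 3) * (1 - x ^ 2) *
        (quadOp (α + 1) 2 (y.comp (2 * X ^ 2 - 1))).eval x := by
  have hd : (y.comp (2 * X ^ 2 - 1)).natDegree < 2 * J := by
    refine lt_of_le_of_lt natDegree_comp_le ?_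
    have : (2 * X ^ 2 - 1 : ℝ[X]).natDegree ≤ 2 := by compute_degree
    nlinarith
  have h := congrArg (fun p => p.eval x) (sum_cPoly_mul α hd)
  simp only [eval_finsetSum, eval_mul, eval_C, eval_sub, eval_one, eval_pow, eval_X,
    eval_iterate_derivative_comp y hJ, Finset.mul_sum] at h
  rw [← h, Finset.sum_comm]
  refine Finset.sum_congr rfl fun j hj => ?_
  have hj := Finset.mem_range.1 hj
  rw [dPoly, eval_finsetSum, Finset.sum_mul]
  refine Finset.sum_subset_zero_on_sdiff (fun i hi => ?_) (fun i hi => ?_) fun i hi => ?_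
  · have hi := Finset.mem_Icc.1 hi
    exact Finset.mem_range.2 (by omega)
  · rw [Finset.mem_sdiff, Finset.mem_Icc] at hi
    split_ifs with hij
    · rw [Nat.choose_eq_zero_of_lt (by omega)]
      simp
    · simp
  · have hi := Finset.mem_Icc.1 hi
    rw [if_pos hi.1, Nat.choose_eq_factorial_div_factorial (by omega : i - j ≤ j),
      Nat.cast_div (Nat.factorial_mul_factorial_dvd_factorial (by omega)) (by positivity),
      show j - (i - j) = 2 * j - i by omega]
    have : (j.factorial : ℝ) ≠ 0 := by positivity
    simp only [eval_mul, eval_C, eval_X_pow]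
    push_cast
    field_simp

theorem sum_xePoly_mul (α : ℝ) (y : ℝ[X]) {J : ℕ} (hJ : y.natDegree < J) (x : ℝ) :
    ∑ j ∈ Finset.range J, (xePoly α j).eval x * (derivative^[j] y).eval (2 * x ^ 2 - 1) =
      (2 * α + 3) * (1 - x ^ 2) *
        (quadOp (α + 1) 2 (X * y.comp (2 * X ^ 2 - 1))).eval x := by
  have hd : (X * y.comp (2 * X ^ 2 - 1)).natDegree < 2 * J := by
    have h1 := natDegree_mul_le (p := (X : ℝ[X])) (q := y.comp (2 * X ^ 2 - 1))
    have h2 : (y.comp (2 * X ^ 2 - 1)).natDegree ≤ _ := natDegree_comp_le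
    have h3 : (2 * X ^ 2 - 1 : ℝ[X]).natDegree ≤ 2 := by compute_degree
    have h4 : (X : ℝ[X]).natDegree = 1 := natDegree_X
    nlinarith
  have h := congrArg (fun p => p.eval x) (sum_cPoly_mul α hd)
  simp only [eval_finsetSum, eval_mul, eval_C, eval_sub, eval_one, eval_pow,
    eval_iterate_derivative_X_mul_comp y hJ, Finset.mul_sum] at h
  rw [eval_X] at h
  rw [← h, Finset.sum_comm]
  refine Finset.sum_congr rfl fun j hj => ?_
  have hj := Finset.mem_range.1 hj
  rw [xePoly, eval_finsetSum, Finset.sum_mul]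
  refine Finset.sum_subset_zero_on_sdiff (fun i hi => ?_) (fun i hi => ?_) fun i hi => ?_
  · have hi := Finset.mem_Icc.1 hi
    exact Finset.mem_range.2 (by omega)
  · rw [Finset.mem_sdiff, Finset.mem_Icc] at hi
    split_ifs with hij
    · rw [Nat.choose_eq_zero_of_lt (by omega)]
      simp
    · simp
  · have hi := Finset.mem_Icc.1 hi
    rcases Nat.eq_zero_or_pos j with rfl | hj0
    · have : cPoly α i = 0 := by
        obtain rfl | rfl : i = 0 ∨ i = 1 := by omega
        · rfl
        · rfl
      simp [this]
    rw [if_pos hi.1, Nat.choose_eq_factorial_div_factorial (by omega : i - j ≤ j + 1),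
      Nat.cast_div (Nat.factorial_mul_factorial_dvd_factorial (by omega)) (by positivity),
      show j + 1 - (i - j) = 2 * j + 1 - i by omega,
      show 3 * j + 2 - i = (3 * j - i) + 2 by omega]
    have : ((j + 1).factorial : ℝ) ≠ 0 := by positivity
    simp only [eval_mul, eval_C, eval_X_pow]
    push_cast
    field_simp
    ring

/-! ### Vanishing and nonvanishing of the coefficients -/

theorem Ring.sum_natChoose_mul_choose (a : ℝ) {n m : ℕ} (h : n ≤ m) :
    ∑ l ∈ Finset.range (n + 1), (n.choose l : ℝ) * Ring.choose a (m - n + l) =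
      Ring.choose (n + a) m := by
  rw [Ring.add_choose_eq_sum_range, ← Finset.sum_range_reflect]
  refine Finset.sum_subset_zero_on_sdiff (Finset.range_subset_range.2 (by omega))
    (fun i hi => ?_) fun i hi => ?_
  · rw [Finset.mem_sdiff, Finset.mem_range, Finset.mem_range] at hi
    rw [Ring.choose_natCast, Nat.choose_eq_zero_of_lt (by omega), Nat.cast_zero, zero_mul]
  · have hi := Finset.mem_range.1 hi
    rw [Ring.choose_natCast, show n + 1 - 1 - i = n - i by omega, Nat.choose_symm (by omega),
      show m - n + (n - i) = m - i by omega]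

theorem eval_one_cPoly (α : ℝ) (i : ℕ) : (cPoly α i).eval 1 = 0 := by
  match i with
  | 0 => simp [cPoly]
  | 1 => simp [cPoly]
  | m + 2 => simp [cPoly]

theorem derivative_cPoly_eval_one (α : ℝ) {i : ℕ} (hi : 2 ≤ i) :
    (derivative (cPoly α i)).eval 1 =
      -2 * (2 * α + 3) * (2 ^ i / (i.factorial : ℝ)) * Ring.choose (α + 1) (i - 2) := by
  obtain ⟨m, rfl⟩ : ∃ m, i = m + 2 := ⟨i - 2, by omega⟩
  rw [cPoly]
  simp only [derivative_mul, derivative_C, derivative_sub, derivative_one, derivative_X_pow]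
  simp [quadPow_eval_one]
  left
  ring

theorem derivative_dPoly_eval_one (α : ℝ) {j : ℕ} (hj : 2 ≤ j) :
    (derivative (dPoly α j)).eval 1 = -2 * (2 * α + 3) * (8 ^ j / (j.factorial : ℝ)) *
      Ring.choose (j + (α + 1)) (2 * j - 2) := by
  rw [← Ring.sum_natChoose_mul_choose _ (by omega : j ≤ 2 * j - 2), dPoly, derivative_sum,
    eval_finsetSum, Finset.mul_sum,
    show Finset.Icc j (2 * j) = Finset.Ico j (2 * j + 1) by
      ext; simp only [Finset.mem_Icc, Finset.mem_Ico]; omega,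
    Finset.sum_Ico_eq_sum_range, show 2 * j + 1 - j = j + 1 by omega]
  refine Finset.sum_congr rfl fun l hl => ?_
  have hl : l ≤ j := by
    have := Finset.mem_range.1 hl
    omega
  rw [derivative_mul, eval_add, eval_mul, eval_mul, eval_one_cPoly,
    derivative_cPoly_eval_one _ (by omega), Nat.add_sub_cancel_left,
    show 2 * j - 2 - j + l = j + l - 2 by omega, show 2 * j - (j + l) = j - l by omega,
    Nat.choose_eq_factorial_div_factorial hl,
    Nat.cast_div (Nat.factorial_mul_factorial_dvd_factorial hl) (by positivity)]
  have h8 : (8 : ℝ) ^ j = 2 ^ (3 * j - (j + l)) * 2 ^ (j + l) := by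
    rw [← pow_add, show 3 * j - (j + l) + (j + l) = 3 * j by omega, pow_mul]
    norm_num
  rw [h8]
  have : (j.factorial : ℝ) ≠ 0 := by positivity
  simp only [eval_mul, eval_C, eval_X_pow, one_pow]
  push_cast
  field_simp
  ring

theorem derivative_xePoly_eval_one (α : ℝ) {j : ℕ} (hj : 2 ≤ j) :
    (2 * (j : ℝ) - 1) * (derivative (xePoly α j)).eval 1 =
      -2 * (2 * α + 3) * (8 ^ j / (j.factorial : ℝ)) *
      ((2 * α + 5) * Ring.choose (j + (α + 1)) (2 * j - 2)) := by
  set a := α + 1 with ha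
  have e0 : (derivative (xePoly α j)).eval 1 = -2 * (2 * α + 3) * (8 ^ j / (j.factorial : ℝ)) *
      (∑ l ∈ Finset.range (j + 2), ((j + 1).choose l : ℝ) * Ring.choose a (2 * j - 1 - (j + 1) + l) +
        ∑ l ∈ Finset.range (j + 1), (j.choose l : ℝ) * Ring.choose a (2 * j - 1 - j + l)) := by
    have e1 : ∑ l ∈ Finset.range (j + 1), (j.choose l : ℝ) * Ring.choose a (2 * j - 1 - j + l) =
        ∑ l ∈ Finset.range (j + 2), (l / (j + 1) : ℝ) * ((j + 1).choose l : ℝ) *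
          Ring.choose a (2 * j - 1 - (j + 1) + l) := by
      rw [Finset.sum_range_succ' (n := j + 1)]
      simp only [Nat.cast_zero, zero_div, zero_mul, add_zero]
      refine Finset.sum_congr rfl fun l _ => ?_
      rw [show 2 * j - 1 - (j + 1) + (l + 1) = 2 * j - 1 - j + l by omega]
      have h := Nat.add_one_mul_choose_eq j l
      have h : ((j : ℝ) + 1) * (j.choose l : ℝ) = ((j + 1).choose (l + 1) : ℝ) * (l + 1) := by
        exact_mod_cast h
      have : (j : ℝ) + 1 ≠ 0 := by positivity
      push_cast
      field_simp
      linear_combination Ring.choose a (2 * j - 1 - j + l) * h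
    rw [e1, ← Finset.sum_add_distrib, xePoly, derivative_sum, eval_finsetSum, Finset.mul_sum,
      show Finset.Icc j (2 * j + 1) = Finset.Ico j (2 * j + 2) by
      ext; simp only [Finset.mem_Icc, Finset.mem_Ico]; omega,
      Finset.sum_Ico_eq_sum_range, show 2 * j + 2 - j = j + 2 by omega]
    refine Finset.sum_congr rfl fun l hl => ?_
    have hl : l ≤ j + 1 := by
      have := Finset.mem_range.1 hl
      omega
    rw [derivative_mul, eval_add, eval_mul, eval_mul, eval_one_cPoly,
      derivative_cPoly_eval_one _ (by omega), Nat.add_sub_cancel_left, ← ha,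
      show 2 * j - 1 - (j + 1) + l = j + l - 2 by omega,
      show 2 * j + 1 - (j + l) = j + 1 - l by omega,
      Nat.choose_eq_factorial_div_factorial hl,
      Nat.cast_div (Nat.factorial_mul_factorial_dvd_factorial hl) (by positivity),
      Nat.factorial_succ (j + l), Nat.factorial_succ j]
    have h8 : (8 : ℝ) ^ j = 2 ^ (3 * j - (j + l)) * 2 ^ (j + l) := by
      rw [← pow_add, show 3 * j - (j + l) + (j + l) = 3 * j by omega, pow_mul]
      norm_num
    rw [h8]
    have : (j.factorial : ℝ) ≠ 0 := by positivity
    have : (j : ℝ) + 1 ≠ 0 := by positivity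
    simp only [eval_mul, eval_C, eval_X_pow, one_pow]
    push_cast
    field_simp
    ring
  have h1 := Ring.sum_natChoose_mul_choose a (by omega : j + 1 ≤ 2 * j - 1)
  have h2 := Ring.sum_natChoose_mul_choose a (by omega : j ≤ 2 * j - 1)
  rw [e0, h1, h2]
  have h3 := Ring.succ_mul_choose_succ' (j + 1 + a) (2 * j - 2)
  have h4 := Ring.succ_mul_choose_succ (j + a) (2 * j - 2)
  rw [show 2 * j - 2 + 1 = 2 * j - 1 by omega, Nat.cast_sub (by omega)] at h3 h4
  rw [show (j : ℝ) + 1 + a - 1 = j + a by ring] at h3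
  push_cast at h3 h4 ⊢
  linear_combination (-2 * (2 * α + 3) * (8 ^ j / (j.factorial : ℝ))) * (h3 + h4)
    + (-2 * (2 * α + 3) * (8 ^ j / (j.factorial : ℝ))) * 2 *
      Ring.choose (j + a) (2 * j - 2) * ha

theorem choose_ne_zero_of_not_natCast {α : ℝ} (hα : -1 < α) (h : ¬ ∃ k : ℕ, α = k) {j : ℕ} :
    Ring.choose (j + (α + 1)) (2 * j - 2) ≠ 0 := by
  refine Ring.choose_ne_zero_of_forall_ne fun i _ hi => h ?_
  have h1 : (j : ℝ) < i := by linarith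
  have h2 : j + 1 ≤ i := by exact_mod_cast h1
  refine ⟨i - (j + 1), ?_⟩
  rw [Nat.cast_sub h2]
  push_cast
  linarith

theorem dPoly_ne_zero {α : ℝ} (hα : -1 < α) (h : ¬ ∃ k : ℕ, α = k) {j : ℕ} (hj : 2 ≤ j) :
    dPoly α j ≠ 0 := by
  intro h0
  have h1 := derivative_dPoly_eval_one α hj
  rw [h0, derivative_zero, eval_zero, eq_comm] at h1
  have h2 : -2 * (2 * α + 3) * ((8 : ℝ) ^ j / (j.factorial : ℝ)) ≠ 0 := by
    refine mul_ne_zero (mul_ne_zero (by norm_num) (by linarith)) (by positivity)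
  exact mul_ne_zero h2 (choose_ne_zero_of_not_natCast hα h) h1

theorem xePoly_ne_zero {α : ℝ} (hα : -1 < α) (h : ¬ ∃ k : ℕ, α = k) {j : ℕ} (hj : 2 ≤ j) :
    xePoly α j ≠ 0 := by
  intro h0
  have h1 := derivative_xePoly_eval_one α hj
  rw [h0, derivative_zero, eval_zero, mul_zero, eq_comm] at h1
  have h2 : -2 * (2 * α + 3) * ((8 : ℝ) ^ j / (j.factorial : ℝ)) ≠ 0 := by
    refine mul_ne_zero (mul_ne_zero (by norm_num) (by linarith)) (by positivity)
  exact mul_ne_zero h2 (mul_ne_zero (by linarith) (choose_ne_zero_of_not_natCast hα h)) h1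

theorem cPoly_natCast_eq_zero (k : ℕ) {i : ℕ} (hi : 2 * k + 4 < i) : cPoly k i = 0 := by
  obtain ⟨m, rfl⟩ : ∃ m, i = m + 2 := ⟨i - 2, by omega⟩
  have := quadPow_natCast_eq_zero (k + 1) (m := m) (by omega)
  push_cast at this
  rw [cPoly, this, mul_zero]

theorem cPoly_natCast_ne_zero (k : ℕ) : cPoly k (2 * k + 4) ≠ 0 := by
  have := quadPow_natCast_two_mul_ne_zero (k + 1)
  push_cast at this
  have h2 : (1 - X ^ 2 : ℝ[X]) ≠ 0 := by
    intro h
    have := congrArg (eval 0) h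
    simp at this
  rw [show 2 * k + 4 = 2 * (k + 1) + 2 by ring, cPoly]
  refine mul_ne_zero (mul_ne_zero ?_ h2) this
  rw [Ne, C_eq_zero]
  positivity

theorem dPoly_natCast_eq_zero (k : ℕ) {j : ℕ} (hj : 2 * k + 4 < j) : dPoly k j = 0 :=
  Finset.sum_eq_zero fun i hi => by
    rw [cPoly_natCast_eq_zero k (hj.trans_le (Finset.mem_Icc.1 hi).1), mul_zero]

theorem xePoly_natCast_eq_zero (k : ℕ) {j : ℕ} (hj : 2 * k + 4 < j) : xePoly k j = 0 :=
  Finset.sum_eq_zero fun i hi => by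
    rw [cPoly_natCast_eq_zero k (hj.trans_le (Finset.mem_Icc.1 hi).1), mul_zero]

theorem dPoly_natCast_ne_zero (k : ℕ) : dPoly k (2 * k + 4) ≠ 0 := by
  rw [dPoly, Finset.sum_eq_single (2 * k + 4)]
  · refine mul_ne_zero (mul_ne_zero ?_ (pow_ne_zero _ X_ne_zero)) (cPoly_natCast_ne_zero k)
    rw [Ne, C_eq_zero]
    positivity
  · intro i hi hne
    have := (Finset.mem_Icc.1 hi).1
    rw [cPoly_natCast_eq_zero k (by omega), mul_zero]
  · intro h
    exact absurd (Finset.mem_Icc.2 ⟨le_rfl, by omega⟩) h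

theorem xePoly_natCast_ne_zero (k : ℕ) : xePoly k (2 * k + 4) ≠ 0 := by
  rw [xePoly, Finset.sum_eq_single (2 * k + 4)]
  · refine mul_ne_zero (mul_ne_zero ?_ (pow_ne_zero _ X_ne_zero)) (cPoly_natCast_ne_zero k)
    rw [Ne, C_eq_zero]
    positivity
  · intro i hi hne
    have := (Finset.mem_Icc.1 hi).1
    rw [cPoly_natCast_eq_zero k (by omega), mul_zero]
  · intro h
    exact absurd (Finset.mem_Icc.2 ⟨le_rfl, by omega⟩) h

theorem diffOrder_eq_top {A : ℕ → ℝ[X]} {J : ℕ} (h : ∀ j, J ≤ j → A j ≠ 0) :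
    diffOrder A = ⊤ := by
  rw [diffOrder, ENat.eq_top_iff_forall_ge]
  intro m
  refine le_trans ?_ (le_iSup₂_of_le (max J m) (h _ (le_max_left _ _)) le_rfl)
  exact_mod_cast le_max_right J m

theorem diffOrder_eq_natCast {A : ℕ → ℝ[X]} {J : ℕ} (h : A J ≠ 0) (h' : ∀ j, J < j → A j = 0) :
    diffOrder A = (J : ℕ∞) := by
  refine le_antisymm (iSup₂_le fun j hj => ?_) (le_iSup₂_of_le J h le_rfl)
  by_contra! hlt
  exact hj (h' j (by exact_mod_cast hlt))

/-- The order of the equation only depends on the coefficients of index at least `3`, if one of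
them does not vanish. -/
theorem diffOrder_eqCoeff {α : ℝ} {N a : ℝ} (hN : 0 < N) {d : ℕ → ℝ[X]} (p₂ p₁ p₀ : ℝ[X])
    (h₁ : (¬ ∃ k : ℕ, α = k) → ∀ j, 2 ≤ j → d j ≠ 0)
    (h₂ : ∀ k : ℕ, α = k → d (2 * k + 4) ≠ 0 ∧ ∀ j, 2 * k + 4 < j → d j = 0) :
    ((¬ ∃ k : ℕ, α = k) → diffOrder (eqCoeff N (withZeroth a d) p₂ p₁ p₀) = ⊤) ∧
      ∀ k : ℕ, α = k →
        diffOrder (eqCoeff N (withZeroth a d) p₂ p₁ p₀) = ((2 * k + 4 : ℕ) : ℕ∞) := by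
  have e : ∀ j, 3 ≤ j → eqCoeff N (withZeroth a d) p₂ p₁ p₀ j = C N * d j := by
    intro j hj
    obtain ⟨i, rfl⟩ : ∃ i, j = i + 3 := ⟨j - 3, by omega⟩
    rfl
  have hC : (C N : ℝ[X]) ≠ 0 := by rw [Ne, C_eq_zero]; exact hN.ne'
  refine ⟨fun h => diffOrder_eq_top (J := 3) fun j hj => ?_, fun k hk =>
    diffOrder_eq_natCast ?_ fun j hj => ?_⟩
  · rw [e j hj]
    exact mul_ne_zero hC (h₁ h j (by omega))
  · rw [e _ (by omega)]
    exact mul_ne_zero hC (h₂ k hk).1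
  · rw [e _ (by omega), (h₂ k hk).2 j hj, mul_zero]

/-! ### The Jacobi integral -/

open MeasureTheory in
theorem intervalIntegrable_jacobi {α β : ℝ} (hα : -1 < α) (hβ : -1 < β) (f : ℝ[X]) :
    IntervalIntegrable (fun x => (1 - x) ^ α * (1 + x) ^ β * f.eval x) volume (-1) 1 := by
  have hα' : IntervalIntegrable (fun x : ℝ => (1 - x) ^ α) volume 0 1 := by
    have h := (intervalIntegral.intervalIntegrable_rpow' (a := 0) (b := 1) hα).comp_sub_left 1
    simpa using h.symm
  have hβ' : IntervalIntegrable (fun x : ℝ => (1 + x) ^ β) volume (-1) 0 := by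
    have h := (intervalIntegral.intervalIntegrable_rpow' (a := 0) (b := 1) hβ).comp_add_left 1
    simpa using h
  refine IntervalIntegrable.mul_continuousOn ?_ f.continuous.continuousOn
  refine IntervalIntegrable.trans (b := 0) ?_ ?_
  · refine IntervalIntegrable.continuousOn_mul hβ' ?_
    refine ContinuousOn.rpow_const (by fun_prop) fun x hx => Or.inl ?_
    rw [Set.uIcc_of_le (by norm_num)] at hx
    linarith [hx.2]
  · refine IntervalIntegrable.mul_continuousOn hα' ?_
    refine ContinuousOn.rpow_const (by fun_prop) fun x hx => Or.inl ?_
    rw [Set.uIcc_of_le (by norm_num)] at hx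
    linarith [hx.1]

/-- The normalizing constant of the Jacobi weight. -/
def jacobiConst (α β : ℝ) : ℝ :=
  Real.Gamma (α + β + 2) / ((2 : ℝ) ^ (α + β + 1) * Real.Gamma (α + 1) * Real.Gamma (β + 1))

theorem jacobiConst_pos {α β : ℝ} (hα : -1 < α) (hβ : -1 < β) : 0 < jacobiConst α β :=
  div_pos (Real.Gamma_pos_of_pos (by linarith)) (mul_pos (mul_pos (by positivity)
    (Real.Gamma_pos_of_pos (by linarith))) (Real.Gamma_pos_of_pos (by linarith)))

/-- The normalized integral against the Jacobi weight. -/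
def jacobiMean {α β : ℝ} (hα : -1 < α) (hβ : -1 < β) : ℝ[X] →ₗ[ℝ] ℝ where
  toFun f := jacobiConst α β * ∫ x in (-1 : ℝ)..1, (1 - x) ^ α * (1 + x) ^ β * f.eval x
  map_add' f g := by
    rw [← mul_add, ← intervalIntegral.integral_add (intervalIntegrable_jacobi hα hβ f)
      (intervalIntegrable_jacobi hα hβ g)]
    simp only [eval_add, mul_add]
  map_smul' c f := by
    simp only [eval_smul, smul_eq_mul, RingHom.id_apply, ← intervalIntegral.integral_const_mul]
    congr 1
    ext x
    ring

theorem genJacobiInner_eq {α β : ℝ} (hα : -1 < α) (hβ : -1 < β) (N : ℝ) (f g : ℝ[X]) :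
    genJacobiInner α β 0 N f g = jacobiMean hα hβ (f * g) + N * (f * g).eval 1 := by
  simp [genJacobiInner, jacobiMean, jacobiConst]

/-- The Pearson equation of the Jacobi weight. -/
theorem jacobiMean_pearson {α β : ℝ} (hα : -1 < α) (hβ : -1 < β) (f : ℝ[X]) :
    jacobiMean hα hβ ((1 - X ^ 2) * derivative f +
      (C (β + 1) * (1 - X) - C (α + 1) * (1 + X)) * f) = 0 := by
  have key := intervalIntegral.integral_eq_sub_of_hasDerivAt_of_le (a := -1) (b := 1)
    (f := fun x : ℝ => (1 - x) ^ (α + 1) * (1 + x) ^ (β + 1) * f.eval x)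
    (f' := fun x : ℝ => (1 - x) ^ α * (1 + x) ^ β * ((1 - X ^ 2) * derivative f +
      (C (β + 1) * (1 - X) - C (α + 1) * (1 + X)) * f).eval x) (by norm_num) ?_ ?_
    (intervalIntegrable_jacobi hα hβ _)
  · change jacobiConst α β * _ = 0
    rw [key]
    have h1 : (0 : ℝ) ^ (α + 1) = 0 := Real.zero_rpow (by linarith)
    have h2 : (0 : ℝ) ^ (β + 1) = 0 := Real.zero_rpow (by linarith)
    simp [h1, h2]
  · refine ContinuousOn.mul (ContinuousOn.mul ?_ ?_) f.continuous.continuousOn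
    · exact ContinuousOn.rpow_const (by fun_prop) fun x _ => Or.inr (by linarith)
    · exact ContinuousOn.rpow_const (by fun_prop) fun x _ => Or.inr (by linarith)
  · intro x hx
    have hx1 : 0 < 1 - x := by linarith [hx.2]
    have hx2 : 0 < 1 + x := by linarith [hx.1]
    have d1 : HasDerivAt (fun x : ℝ => (1 - x) ^ (α + 1)) (-1 * (α + 1) * (1 - x) ^ α) x := by
      have := ((hasDerivAt_id x).const_sub 1).rpow_const (p := α + 1) (Or.inl hx1.ne')
      simpa using this
    have d2 : HasDerivAt (fun x : ℝ => (1 + x) ^ (β + 1)) (1 * (β + 1) * (1 + x) ^ β) x := by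
      have := ((hasDerivAt_id x).const_add 1).rpow_const (p := β + 1) (Or.inl hx2.ne')
      simpa using this
    refine ((d1.mul d2).mul (f.hasDerivAt x)).congr_deriv ?_
    simp
    rw [Real.rpow_add_one hx1.ne', Real.rpow_add_one hx2.ne']
    ring

theorem integral_jacobi {α β : ℝ} (hα : -1 < α) (hβ : -1 < β) :
    ∫ x in (-1 : ℝ)..1, (1 - x) ^ α * (1 + x) ^ β =
      2 ^ (α + β + 1) * Real.Gamma (α + 1) * Real.Gamma (β + 1) / Real.Gamma (α + β + 2) := by
  have h1 := ProbabilityTheory.beta_eq_betaIntegralReal (β + 1) (α + 1) (by linarith) (by linarith)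
  have h2 : Complex.betaIntegral ((β + 1 : ℝ) : ℂ) ((α + 1 : ℝ) : ℂ) =
      ((∫ s in (0 : ℝ)..1, s ^ β * (1 - s) ^ α : ℝ) : ℂ) := by
    rw [Complex.betaIntegral, ← intervalIntegral.integral_ofReal]
    refine intervalIntegral.integral_congr fun s hs => ?_
    rw [Set.uIcc_of_le (by norm_num)] at hs
    have e1 : (((β + 1 : ℝ) : ℂ) - 1) = ((β : ℝ) : ℂ) := by push_cast; ring
    have e2 : (((α + 1 : ℝ) : ℂ) - 1) = ((α : ℝ) : ℂ) := by push_cast; ring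
    have e3 : (1 - (s : ℂ)) = ((1 - s : ℝ) : ℂ) := by push_cast; ring
    simp only [e1, e2, e3]
    rw [← Complex.ofReal_cpow hs.1, ← Complex.ofReal_cpow (by linarith [hs.2]),
      ← Complex.ofReal_mul]
  rw [h2, Complex.ofReal_re, ProbabilityTheory.beta,
    show β + 1 + (α + 1) = α + β + 2 by ring] at h1
  have h3 : ∫ s in (0 : ℝ)..1, (1 - (2 * s - 1)) ^ α * (1 + (2 * s - 1)) ^ β =
      2 ^ (α + β) * ∫ s in (0 : ℝ)..1, s ^ β * (1 - s) ^ α := by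
    rw [← intervalIntegral.integral_const_mul]
    refine intervalIntegral.integral_congr fun s hs => ?_
    rw [Set.uIcc_of_le (by norm_num)] at hs
    rw [show 1 - (2 * s - 1) = 2 * (1 - s) by ring, show 1 + (2 * s - 1) = 2 * s by ring,
      Real.mul_rpow (by norm_num) (by linarith [hs.2]), Real.mul_rpow (by norm_num) hs.1,
      Real.rpow_add (by norm_num)]
    ring
  have h4 := intervalIntegral.integral_comp_mul_sub (a := 0) (b := 1)
    (fun x : ℝ => (1 - x) ^ α * (1 + x) ^ β) (two_ne_zero : (2 : ℝ) ≠ 0) 1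
  rw [h3, ← h1] at h4
  norm_num at h4
  rw [Real.rpow_add_one (by norm_num)]
  rw [← mul_right_inj' (by norm_num : (1 / 2 : ℝ) ≠ 0), ← h4]
  ring

theorem jacobiMean_one {α β : ℝ} (hα : -1 < α) (hβ : -1 < β) : jacobiMean hα hβ 1 = 1 := by
  change jacobiConst α β * ∫ x in (-1 : ℝ)..1, (1 - x) ^ α * (1 + x) ^ β * (1 : ℝ[X]).eval x = 1
  simp only [eval_one, mul_one]
  have h1 := (Real.Gamma_pos_of_pos (by linarith : 0 < α + 1)).ne'
  have h2 := (Real.Gamma_pos_of_pos (by linarith : 0 < β + 1)).ne'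
  have h3 := (Real.Gamma_pos_of_pos (by linarith : 0 < α + β + 2)).ne'
  have h4 : (2 : ℝ) ^ (α + β + 1) ≠ 0 := by positivity
  rw [integral_jacobi hα hβ, jacobiConst]
  field_simp

open MeasureTheory in
theorem jacobiMean_mul_self_pos {α β : ℝ} (hα : -1 < α) (hβ : -1 < β) {f : ℝ[X]} (hf : f ≠ 0) :
    0 < jacobiMean hα hβ (f * f) := by
  refine mul_pos (jacobiConst_pos hα hβ) ?_
  rw [intervalIntegral.integral_pos_iff_support_of_nonneg_ae' ?_
    (intervalIntegrable_jacobi hα hβ _)]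
  · refine ⟨by norm_num, ?_⟩
    have h1 : Set.Ioo (-1 : ℝ) 1 \ (f.roots.toFinset : Set ℝ) ⊆
        (Function.support fun x => (1 - x) ^ α * (1 + x) ^ β * (f * f).eval x) ∩
          Set.Ioc (-1) 1 := by
      intro x hx
      have hr : f.eval x ≠ 0 := fun h => hx.2 (by simp [hf, h])
      have hx1 : 0 < 1 - x := by linarith [hx.1.2]
      have hx2 : 0 < 1 + x := by linarith [hx.1.1]
      refine ⟨?_, hx.1.1, hx.1.2.le⟩
      rw [Function.mem_support, eval_mul]
      exact mul_ne_zero (by positivity) (mul_ne_zero hr hr)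
    refine lt_of_lt_of_le ?_ (measure_mono h1)
    rw [measure_sdiff_null (Finset.measure_zero _ _)]
    simp
  · rw [Set.uIoc_of_le (by norm_num)]
    refine (ae_restrict_iff' measurableSet_Ioc).2 (Filter.Eventually.of_forall fun x hx => ?_)
    have hx1 : 0 ≤ 1 - x := by linarith [hx.2]
    have hx2 : 0 ≤ 1 + x := by linarith [hx.1]
    change 0 ≤ (1 - x) ^ α * (1 + x) ^ β * (f * f).eval x
    rw [eval_mul]
    exact mul_nonneg (by positivity) (mul_self_nonneg _)

/-! ### Pochhammer symbols and the Chu–Vandermonde identity -/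

theorem ascPochhammer_succ_left_eval (x : ℝ) (n : ℕ) :
    (ascPochhammer ℝ (n + 1)).eval x = x * (ascPochhammer ℝ n).eval (x + 1) := by
  rw [ascPochhammer_succ_left]
  simp

theorem ascPochhammer_eval_one_sub (x : ℝ) (n : ℕ) :
    (ascPochhammer ℝ n).eval (1 - x - n) = (-1) ^ n * (ascPochhammer ℝ n).eval x := by
  induction n with
  | zero => simp
  | succ n ih =>
    rw [ascPochhammer_succ_left_eval, ascPochhammer_succ_eval,
      show 1 - x - ((n + 1 : ℕ) : ℝ) + 1 = 1 - x - n by push_cast; ring, ih]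
    push_cast
    ring

theorem ascPochhammer_two_mul (x : ℝ) (n : ℕ) :
    (ascPochhammer ℝ (2 * n)).eval (2 * x) =
      4 ^ n * (ascPochhammer ℝ n).eval x * (ascPochhammer ℝ n).eval (x + 1 / 2) := by
  induction n with
  | zero => simp
  | succ n ih =>
    rw [show 2 * (n + 1) = 2 * n + 1 + 1 by ring]
    simp only [ascPochhammer_succ_eval, ih]
    push_cast
    ring

theorem factorial_two_mul_eq_ascPochhammer (n : ℕ) :
    ((2 * n).factorial : ℝ) = 4 ^ n * n.factorial * (ascPochhammer ℝ n).eval (1 / 2) := by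
  have h := ascPochhammer_two_mul (1 / 2) n
  norm_num at h
  rw [h]
  ring

theorem chu_vandermonde (n : ℕ) (b : ℝ) {c : ℝ} (hc : 0 < c) :
    ∑ k ∈ Finset.range (n + 1), (-1) ^ k * (n.choose k : ℝ) *
      ((ascPochhammer ℝ k).eval b / (ascPochhammer ℝ k).eval c) =
      (ascPochhammer ℝ n).eval (c - b) / (ascPochhammer ℝ n).eval c := by
  induction n generalizing c with
  | zero => simp
  | succ n ih =>
    have hpos : ∀ k, 0 < (ascPochhammer ℝ k).eval c := fun k => ascPochhammer_pos k c hc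
    have hpos' : ∀ k, 0 < (ascPochhammer ℝ k).eval (c + 1) :=
      fun k => ascPochhammer_pos k _ (by linarith)
    set u : ℕ → ℝ := fun k => (ascPochhammer ℝ k).eval b / (ascPochhammer ℝ k).eval c with hu
    have e1 : ∑ k ∈ Finset.range (n + 1 + 1), (-1) ^ k * ((n + 1).choose k : ℝ) * u k =
        ∑ k ∈ Finset.range (n + 1), (-1) ^ k * (n.choose k : ℝ) * (u k - u (k + 1)) := by
      have e2 : ∑ k ∈ Finset.range (n + 1), (-1) ^ k * (n.choose k : ℝ) * u k =
          ∑ k ∈ Finset.range (n + 1), (-1) ^ (k + 1) * (n.choose (k + 1) : ℝ) * u (k + 1) + u 0 := by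
        have := Finset.sum_range_succ' (fun k => (-1) ^ k * (n.choose k : ℝ) * u k) (n + 1)
        rw [Finset.sum_range_succ, Nat.choose_succ_self] at this
        simpa using this
      simp only [mul_sub]
      rw [Finset.sum_sub_distrib, e2, Finset.sum_range_succ', add_sub_right_comm,
        ← Finset.sum_sub_distrib]
      congr 1
      · refine Finset.sum_congr rfl fun k _ => ?_
        rw [Nat.choose_succ_succ]
        push_cast
        ring
      · simp
    have e3 : ∀ k, u k - u (k + 1) = (c - b) / c *
        ((ascPochhammer ℝ k).eval b / (ascPochhammer ℝ k).eval (c + 1)) := by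
      intro k
      have h1 := ascPochhammer_succ_left_eval c k
      have h2 := ascPochhammer_succ_eval k c
      have h3 := (hpos k).ne'
      have h4 := (hpos' k).ne'
      have h5 : c + k ≠ 0 := by positivity
      have h6 : (ascPochhammer ℝ k).eval (c + 1) = (ascPochhammer ℝ k).eval c * (c + k) / c := by
        rw [← h2, h1]
        field_simp
      simp only [hu]
      rw [h6, h2, ascPochhammer_succ_eval]
      field_simp
      ring
    rw [e1]
    simp only [e3]
    have e4 : ∀ k, (-1) ^ k * (n.choose k : ℝ) * ((c - b) / c *
        ((ascPochhammer ℝ k).eval b / (ascPochhammer ℝ k).eval (c + 1))) = (c - b) / c *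
        ((-1) ^ k * (n.choose k : ℝ) *
        ((ascPochhammer ℝ k).eval b / (ascPochhammer ℝ k).eval (c + 1))) := fun k => by ring
    simp only [e4]
    rw [← Finset.mul_sum, ih (by linarith), ascPochhammer_succ_left_eval,
      ascPochhammer_succ_left_eval, show c + 1 - b = c - b + 1 by ring]
    have h4 := (hpos' n).ne'
    field_simp

/-! ### Jacobi polynomials -/

/-- The coefficient of `(1 + t) ^ k` in the Jacobi polynomial of degree `n`, normalized at `-1`. -/
def jacobiCoeff (α β : ℝ) (n k : ℕ) : ℝ :=
  (-1) ^ k * (n.choose k : ℝ) * ((ascPochhammer ℝ k).eval (n + α + β + 1) /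
    ((ascPochhammer ℝ k).eval (β + 1) * 2 ^ k))

/-- The Jacobi polynomial of degree `n` with value `1` at `-1`. -/
def jacobiPoly (α β : ℝ) (n : ℕ) : ℝ[X] :=
  ∑ k ∈ Finset.range (n + 1), C (jacobiCoeff α β n k) * (X + 1) ^ k

theorem jacobiCoeff_succ (α : ℝ) {β : ℝ} (hβ : -1 < β) (n k : ℕ) :
    2 * (k + 1) * (k + β + 1) * jacobiCoeff α β n (k + 1) =
      (k - n) * (k + n + α + β + 1) * jacobiCoeff α β n k := by
  have h1 : (ascPochhammer ℝ k).eval (β + 1) ≠ 0 := (ascPochhammer_pos k _ (by linarith)).ne'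
  have h2 : β + 1 + k ≠ 0 := by
    have : (0 : ℝ) ≤ k := by positivity
    linarith
  have h3 : ((k : ℝ) + 1) * (n.choose (k + 1) : ℝ) = (n - k) * (n.choose k : ℝ) := by
    rcases Nat.lt_or_ge n k with h | h
    · rw [Nat.choose_eq_zero_of_lt h, Nat.choose_eq_zero_of_lt (by omega)]
      simp
    · rw [← Nat.cast_sub h]
      have := Nat.choose_succ_right_eq n k
      have : (n.choose (k + 1) : ℝ) * (k + 1) = n.choose k * (n - k : ℕ) := by exact_mod_cast this
      linarith
  rw [jacobiCoeff, jacobiCoeff, ascPochhammer_succ_eval, ascPochhammer_succ_eval, pow_succ,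
    pow_succ]
  have e : 2 * ((k : ℝ) + 1) * (k + β + 1) * ((-1) ^ k * -1 * (n.choose (k + 1) : ℝ) *
      ((ascPochhammer ℝ k).eval (n + α + β + 1) * (n + α + β + 1 + k) /
      ((ascPochhammer ℝ k).eval (β + 1) * (β + 1 + k) * (2 ^ k * 2)))) =
      -((k + 1) * (n.choose (k + 1) : ℝ)) * (-1) ^ k * ((ascPochhammer ℝ k).eval (n + α + β + 1) *
      (n + α + β + 1 + k) / ((ascPochhammer ℝ k).eval (β + 1) * 2 ^ k)) := by
    field_simp
    ring
  rw [e, h3]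
  ring

/-- The Jacobi differential operator. -/
def jacobiOp (α β : ℝ) (f : ℝ[X]) : ℝ[X] :=
  (1 - X ^ 2) * derivative (derivative f) + (C (β - α) - C (α + β + 2) * X) * derivative f

theorem jacobiPoly_ode (α : ℝ) {β : ℝ} (hβ : -1 < β) (n : ℕ) :
    jacobiOp α β (jacobiPoly α β n) = -C (n * (n + α + β + 1)) * jacobiPoly α β n := by
  set j : ℝ[X] := ∑ k ∈ Finset.range (n + 1), C (jacobiCoeff α β n k) * X ^ k with hj
  have hjc : jacobiPoly α β n = j.comp (X + 1) := by
    simp [jacobiPoly, hj, Polynomial.sum_comp]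
  have hco : ∀ k, j.coeff k = jacobiCoeff α β n k := by
    intro k
    simp only [hj, finsetSum_coeff, coeff_C_mul_X_pow]
    rw [Finset.sum_ite_eq]
    split_ifs with h
    · rfl
    · rw [Finset.mem_range] at h
      rw [jacobiCoeff, Nat.choose_eq_zero_of_lt (by omega)]
      simp
  have key : C 2 * (X * derivative (derivative j)) - X * (X * derivative (derivative j)) +
      (C (2 * (β + 1)) * derivative j - C (α + β + 2) * (X * derivative j)) +
      C (n * (n + α + β + 1)) * j = 0 := by
    ext k
    simp only [coeff_add, coeff_sub, coeff_C_mul, coeff_zero]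
    match k with
    | 0 =>
      have := jacobiCoeff_succ α hβ n 0
      simp [coeff_derivative, hco] at this ⊢
      linarith
    | 1 =>
      have := jacobiCoeff_succ α hβ n 1
      simp [coeff_X_mul, coeff_derivative, hco] at this ⊢
      linarith
    | k + 2 =>
      have := jacobiCoeff_succ α hβ n (k + 2)
      simp [coeff_X_mul, coeff_derivative, hco] at this ⊢
      linarith
  have h := congrArg (fun p => p.comp (X + 1)) key
  rw [hjc, jacobiOp]
  simp only [derivative_comp, derivative_add, derivative_X, derivative_one, derivative_mul]
  refine funext fun x => ?_
  have h := congrArg (fun p => p.eval x) h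
  simp at h ⊢
  linear_combination h

theorem natDegree_jacobiPoly_le (α β : ℝ) (n : ℕ) : (jacobiPoly α β n).natDegree ≤ n := by
  refine natDegree_sum_le_of_forall_le _ _ fun k hk => (natDegree_C_mul_le _ _).trans ?_
  refine natDegree_pow_le.trans ?_
  have h1 : (X + 1 : ℝ[X]).natDegree ≤ 1 := by compute_degree
  have := Finset.mem_range.1 hk
  nlinarith

theorem jacobiPoly_eval_one {α β : ℝ} (hβ : -1 < β) (n : ℕ) :
    (jacobiPoly α β n).eval 1 =
      (-1) ^ n * (ascPochhammer ℝ n).eval (α + 1) / (ascPochhammer ℝ n).eval (β + 1) := by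
  have h := chu_vandermonde n (n + α + β + 1) (show 0 < β + 1 by linarith)
  rw [show β + 1 - (n + α + β + 1) = 1 - (α + 1) - n by ring, ascPochhammer_eval_one_sub] at h
  rw [← h, jacobiPoly, eval_finsetSum]
  refine Finset.sum_congr rfl fun k _ => ?_
  have h1 : (ascPochhammer ℝ k).eval (β + 1) ≠ 0 := (ascPochhammer_pos k _ (by linarith)).ne'
  simp only [eval_mul, eval_C, eval_pow, eval_add, eval_X, eval_one, jacobiCoeff]
  norm_num
  field_simp

/-! ### Orthogonality -/

section
variable {α β : ℝ} (hα : -1 < α) (hβ : -1 < β)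

theorem jacobiMean_mul_jacobiOp_comm (p f : ℝ[X]) :
    jacobiMean hα hβ (p * jacobiOp α β f) = jacobiMean hα hβ (f * jacobiOp α β p) := by
  rw [← sub_eq_zero, ← map_sub]
  have h := jacobiMean_pearson hα hβ (p * derivative f - f * derivative p)
  rw [← h]
  congr 1
  rw [jacobiOp, jacobiOp]
  simp only [derivative_sub, derivative_mul]
  refine funext fun x => ?_
  simp
  ring

theorem jacobiOp_X_add_one_pow (α β : ℝ) (d : ℕ) :
    jacobiOp α β ((X + 1) ^ (d + 1)) = C (2 * (d + 1) * (d + 1 + β)) * (X + 1) ^ d -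
      C ((d + 1) * (d + 1 + α + β + 1)) * (X + 1) ^ (d + 1) := by
  rw [jacobiOp]
  cases d with
  | zero =>
    refine funext fun x => ?_
    simp
    ring
  | succ d =>
    simp only [derivative_pow, derivative_add, derivative_X, derivative_one, derivative_mul,
      derivative_C, Nat.add_sub_cancel]
    refine funext fun x => ?_
    simp
    ring

theorem jacobiMean_jacobiPoly_mul_pow (n : ℕ) {d : ℕ} (hd : d < n) :
    jacobiMean hα hβ (jacobiPoly α β n * (X + 1) ^ d) = 0 := by
  have key : ∀ f : ℝ[X], jacobiMean hα hβ (jacobiPoly α β n * jacobiOp α β f) =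
      -(n * (n + α + β + 1)) * jacobiMean hα hβ (jacobiPoly α β n * f) := by
    intro f
    rw [jacobiMean_mul_jacobiOp_comm, jacobiPoly_ode α hβ, ← smul_eq_mul (a := -(n * (n + α + β + 1))),
      ← map_smul]
    congr 1
    rw [smul_eq_C_mul, C_neg]
    ring
  induction d with
  | zero =>
    have h := key 1
    have h0 : jacobiOp α β 1 = 0 := by simp [jacobiOp]
    rw [h0, mul_zero, map_zero, eq_comm] at h
    rw [pow_zero]
    refine (mul_eq_zero.1 h).resolve_left ?_
    have : (1 : ℝ) ≤ n := by exact_mod_cast hd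
    have : 0 < n * (n + α + β + 1) := by
      apply mul_pos <;> linarith
    linarith
  | succ d ih =>
    have h := key ((X + 1) ^ (d + 1))
    have ih := ih (by omega)
    have e : jacobiPoly α β n * jacobiOp α β ((X + 1) ^ (d + 1)) =
        (2 * (d + 1) * (d + 1 + β)) • (jacobiPoly α β n * (X + 1) ^ d) -
        (((d : ℝ) + 1) * (d + 1 + α + β + 1)) • (jacobiPoly α β n * (X + 1) ^ (d + 1)) := by
      rw [jacobiOp_X_add_one_pow, smul_eq_C_mul, smul_eq_C_mul]
      ring
    rw [e, map_sub, map_smul, map_smul, ih, smul_zero, zero_sub, smul_eq_mul] at h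
    have h2 : (((n : ℝ) - (d + 1)) * (n + d + 1 + α + β + 1)) *
        jacobiMean hα hβ (jacobiPoly α β n * (X + 1) ^ (d + 1)) = 0 := by
      linear_combination h
    refine (mul_eq_zero.1 h2).resolve_left ?_
    have h3 : (d : ℝ) + 1 < n := by exact_mod_cast hd
    have h4 : (0 : ℝ) ≤ d := by positivity
    exact (mul_pos (by linarith) (by linarith)).ne'

theorem jacobiMean_jacobiPoly_mul (n : ℕ) {f : ℝ[X]} (hf : f.natDegree < n) :
    jacobiMean hα hβ (jacobiPoly α β n * f) = 0 := by
  have h : f = ((taylor (-1)) f).comp (X + 1) := by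
    rw [taylor_apply, comp_assoc]
    simp
  rw [h, as_sum_range_C_mul_X_pow ((taylor (-1)) f), Polynomial.sum_comp, Finset.mul_sum, map_sum]
  refine Finset.sum_eq_zero fun i hi => ?_
  have hi := Finset.mem_range.1 hi
  rw [natDegree_taylor] at hi
  have e : jacobiPoly α β n * (C (((taylor (-1)) f).coeff i) * X ^ i).comp (X + 1) =
      ((taylor (-1)) f).coeff i • (jacobiPoly α β n * (X + 1) ^ i) := by
    rw [smul_eq_C_mul]
    simp only [mul_comp, C_comp, pow_comp, X_comp]
    ring
  rw [e, map_smul, jacobiMean_jacobiPoly_mul_pow hα hβ n (by omega), smul_zero]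

theorem jacobiMean_X_add_one_pow (k : ℕ) :
    jacobiMean hα hβ ((X + 1) ^ k) =
      2 ^ k * (ascPochhammer ℝ k).eval (β + 1) / (ascPochhammer ℝ k).eval (α + β + 2) := by
  induction k with
  | zero => simp [jacobiMean_one]
  | succ k ih =>
    have h := jacobiMean_pearson hα hβ ((X + 1) ^ k)
    have e : (1 - X ^ 2) * derivative ((X + 1) ^ k : ℝ[X]) +
        (C (β + 1) * (1 - X) - C (α + 1) * (1 + X)) * (X + 1) ^ k =
        (2 * (k + β + 1)) • (X + 1) ^ k - (k + α + β + 2) • (X + 1) ^ (k + 1) := by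
      rw [smul_eq_C_mul, smul_eq_C_mul]
      cases k with
      | zero =>
        refine funext fun x => ?_
        simp
        ring
      | succ k =>
        rw [derivative_pow]
        refine funext fun x => ?_
        simp
        ring
    rw [e, map_sub, map_smul, map_smul, ih, smul_eq_mul, smul_eq_mul] at h
    have hk : (0 : ℝ) ≤ k := by positivity
    have h1 : α + β + 2 + k ≠ 0 := by linarith
    have h2 : (ascPochhammer ℝ k).eval (α + β + 2) ≠ 0 :=
      (ascPochhammer_pos k _ (by linarith)).ne'
    have h1' : (k : ℝ) + α + β + 2 ≠ 0 := by linarith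
    apply mul_left_cancel₀ h1'
    rw [ascPochhammer_succ_eval, ascPochhammer_succ_eval]
    have h3 : (k + α + β + 2) * jacobiMean hα hβ ((X + 1) ^ (k + 1)) =
      2 * (k + β + 1) * (2 ^ k * (ascPochhammer ℝ k).eval (β + 1) /
        (ascPochhammer ℝ k).eval (α + β + 2)) := by linarith
    rw [h3]
    field_simp
    ring

theorem jacobiMean_X_add_one_mul_derivative {n : ℕ} (hn : 1 ≤ n) :
    jacobiMean hα hβ ((X + 1) * derivative (jacobiPoly α β n)) =
      (-1) ^ n * n.factorial * (n + α + β + 1) / (ascPochhammer ℝ n).eval (α + β + 2) := by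
  obtain ⟨m, rfl⟩ : ∃ m, n = m + 1 := ⟨n - 1, by omega⟩
  have e : (X + 1) * derivative (jacobiPoly α β (m + 1)) = ∑ k ∈ Finset.range (m + 1 + 1),
      (jacobiCoeff α β (m + 1) k * k) • (X + 1 : ℝ[X]) ^ k := by
    rw [jacobiPoly, derivative_sum, Finset.mul_sum]
    refine Finset.sum_congr rfl fun k _ => ?_
    rw [smul_eq_C_mul]
    cases k with
    | zero => simp
    | succ k =>
      rw [derivative_C_mul, derivative_pow, C_mul]
      simp only [derivative_add, derivative_X, derivative_one, Nat.add_sub_cancel]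
      ring
  have hcv := chu_vandermonde m (m + 1 + α + β + 2) (show 0 < α + β + 3 by linarith)
  rw [show α + β + 3 - (m + 1 + α + β + 2) = 1 - 1 - m by ring, ascPochhammer_eval_one_sub,
    ascPochhammer_eval_one] at hcv
  rw [e, map_sum, Finset.sum_range_succ']
  have hz : jacobiMean hα hβ ((jacobiCoeff α β (m + 1) 0 * (0 : ℕ)) • (X + 1 : ℝ[X]) ^ 0) = 0 := by
    simp
  rw [hz, add_zero]
  have hc : α + β + 2 ≠ 0 := by linarith
  have h1 : (ascPochhammer ℝ m).eval (α + β + 3) ≠ 0 := (ascPochhammer_pos m _ (by linarith)).ne'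
  have e2 : ∀ k ∈ Finset.range (m + 1), jacobiMean hα hβ
      ((jacobiCoeff α β (m + 1) (k + 1) * (k + 1 : ℕ)) • (X + 1 : ℝ[X]) ^ (k + 1)) =
      -((m + 1) * (m + 1 + α + β + 1) / (α + β + 2)) * ((-1) ^ k * (m.choose k : ℝ) *
      ((ascPochhammer ℝ k).eval (m + 1 + α + β + 2) / (ascPochhammer ℝ k).eval (α + β + 3))) := by
    intro k _
    have h2 : (ascPochhammer ℝ (k + 1)).eval (β + 1) ≠ 0 :=
      (ascPochhammer_pos _ _ (by linarith)).ne'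
    have h3 : (ascPochhammer ℝ k).eval (α + β + 3) ≠ 0 :=
      (ascPochhammer_pos k _ (by linarith)).ne'
    have h4 : ((m : ℝ) + 1) * (m.choose k : ℝ) = ((m + 1).choose (k + 1) : ℝ) * (k + 1) := by
      exact_mod_cast Nat.add_one_mul_choose_eq m k
    rw [map_smul, jacobiMean_X_add_one_pow, smul_eq_mul, jacobiCoeff,
      ascPochhammer_succ_left_eval (α + β + 2), ascPochhammer_succ_left_eval (_ + α + β + 1),
      show α + β + 2 + 1 = α + β + 3 by ring,
      show ((m + 1 : ℕ) : ℝ) + α + β + 1 + 1 = m + 1 + α + β + 2 by push_cast; ring]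
    push_cast
    field_simp
    linear_combination (m + 1 + α + β + 1) * (-1) ^ k *
      (ascPochhammer ℝ k).eval (m + 1 + α + β + 2) * h4
  rw [Finset.sum_congr rfl e2, ← Finset.mul_sum, hcv, ascPochhammer_succ_left_eval,
    show α + β + 2 + 1 = α + β + 3 by ring, Nat.factorial_succ]
  push_cast
  field_simp
  ring

/-- The polynomial `(1 - t) ((1 + t) p'' + (β + 1) p')` for the Jacobi polynomial `p` of
degree `n`. -/
def jacobiCorrection (α β : ℝ) (n : ℕ) : ℝ[X] :=
  (1 - X) * ((X + 1) * derivative (derivative (jacobiPoly α β n)) +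
    C (β + 1) * derivative (jacobiPoly α β n))

theorem jacobiCorrection_eq (α : ℝ) {β : ℝ} (hβ : -1 < β) (n : ℕ) :
    jacobiCorrection α β n = C (α + 1) * (1 + X) * derivative (jacobiPoly α β n) -
      C (n * (n + α + β + 1)) * jacobiPoly α β n := by
  have h := jacobiPoly_ode α hβ n
  rw [jacobiOp] at h
  rw [jacobiCorrection]
  refine funext fun x => ?_
  have h := congrArg (fun p => p.eval x) h
  simp at h ⊢
  linear_combination h

theorem jacobiMean_jacobiCorrection {n : ℕ} (hn : 1 ≤ n) :
    jacobiMean hα hβ (jacobiCorrection α β n) = (α + 1) * ((-1) ^ n * n.factorial *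
      (n + α + β + 1) / (ascPochhammer ℝ n).eval (α + β + 2)) := by
  have h0 := jacobiMean_jacobiPoly_mul hα hβ n (f := 1) (by rw [natDegree_one]; omega)
  rw [mul_one] at h0
  have e : jacobiCorrection α β n = (α + 1) • ((X + 1) * derivative (jacobiPoly α β n)) -
      (n * (n + α + β + 1)) • jacobiPoly α β n := by
    rw [jacobiCorrection_eq α hβ, smul_eq_C_mul, smul_eq_C_mul]
    ring
  rw [e, map_sub, map_smul, map_smul, h0, jacobiMean_X_add_one_mul_derivative hα hβ hn]
  simp

theorem jacobiMean_jacobiCorrection_mul {n : ℕ} {h : ℝ[X]} (hh : h.natDegree + 2 ≤ n) :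
    jacobiMean hα hβ (jacobiCorrection α β n * ((1 - X) * h)) = 0 := by
  set p := jacobiPoly α β n with hp
  obtain ⟨H, rfl, hHd⟩ := exists_derivative_eq h
  have d1 : ((1 - X) * derivative H).natDegree < n := by
    have h1 : (1 - X : ℝ[X]).natDegree ≤ 1 := by compute_degree
    have h2 := natDegree_mul_le (p := (1 - X : ℝ[X])) (q := derivative H)
    omega
  have h1 := jacobiMean_jacobiPoly_mul hα hβ n d1
  have h2 := jacobiMean_jacobiPoly_mul hα hβ n (f := H) (by omega)
  have h3 := jacobiMean_pearson hα hβ (H * derivative p)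
  have h4 := jacobiPoly_ode α hβ n
  rw [← hp] at h1 h2 h4
  have e : jacobiCorrection α β n * ((1 - X) * derivative H) =
      (α + 1) • ((1 - X ^ 2) * derivative (H * derivative p) +
        (C (β + 1) * (1 - X) - C (α + 1) * (1 + X)) * (H * derivative p)) +
      ((α + 1) * (n * (n + α + β + 1))) • (p * H) -
      (n * (n + α + β + 1)) • (p * ((1 - X) * derivative H)) := by
    rw [jacobiCorrection_eq α hβ, ← hp, smul_eq_C_mul, smul_eq_C_mul, smul_eq_C_mul,
      derivative_mul]
    rw [jacobiOp] at h4
    refine funext fun x => ?_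
    have h4 := congrArg (fun p => p.eval x) h4
    simp at h4 ⊢
    linear_combination (-(α + 1) * H.eval x) * h4
  rw [e, map_sub, map_add, map_smul, map_smul, map_smul, h1, h2, h3]
  simp

/-- The orthogonal polynomial of degree `n` for the Jacobi weight with an additional mass `N`
at `1`, if `κ` is the right constant. -/
theorem jacobiMean_add_eval_one_eq_zero (N κ : ℝ) {n : ℕ}
    (hκ : κ * (α + 1) * (n.factorial * (n + α + β + 1) * (ascPochhammer ℝ n).eval (β + 1)) =
      (ascPochhammer ℝ n).eval (α + 1) * (ascPochhammer ℝ n).eval (α + β + 2))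
    {f : ℝ[X]} (hf : f.degree < n) :
    jacobiMean hα hβ ((jacobiPoly α β n - C (N * κ) * jacobiCorrection α β n) * f) +
      N * ((jacobiPoly α β n - C (N * κ) * jacobiCorrection α β n) * f).eval 1 = 0 := by
  rcases Nat.eq_zero_or_pos n with rfl | hn
  · obtain rfl : f = 0 := by
      rw [← degree_eq_bot, ← Nat.WithBot.lt_zero_iff]; exact_mod_cast hf
    simp
  have hfn : f.natDegree < n := by
    rcases eq_or_ne f 0 with rfl | hf0
    · simpa using hn
    · exact (natDegree_lt_iff_degree_lt hf0).2 hf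
  set p := jacobiPoly α β n with hp
  set Y := p - C (N * κ) * jacobiCorrection α β n with hY
  have hY1 : Y.eval 1 = p.eval 1 := by simp [hY, jacobiCorrection]
  obtain ⟨g, hg⟩ : (X - C 1 : ℝ[X]) ∣ f - C (f.eval 1) := by
    rw [dvd_iff_isRoot]; simp
  have hf2 : f = C (f.eval 1) + (1 - X) * (-g) := by
    rw [C_1] at hg
    linear_combination hg
  have z1 : jacobiMean hα hβ Y + N * Y.eval 1 = 0 := by
    have h0 := jacobiMean_jacobiPoly_mul hα hβ n (f := 1) (by rw [natDegree_one]; omega)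
    rw [mul_one, ← hp] at h0
    have h1 : (ascPochhammer ℝ n).eval (β + 1) ≠ 0 := (ascPochhammer_pos n _ (by linarith)).ne'
    have h2 : (ascPochhammer ℝ n).eval (α + β + 2) ≠ 0 :=
      (ascPochhammer_pos n _ (by linarith)).ne'
    rw [hY1, hp, jacobiPoly_eval_one hβ, hY, ← smul_eq_C_mul, map_sub, map_smul, h0,
      jacobiMean_jacobiCorrection hα hβ hn, smul_eq_mul]
    field_simp
    linear_combination (-N * (-1) ^ n) * hκ
  have z2 : jacobiMean hα hβ (Y * ((1 - X) * (-g))) = 0 := by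
    by_cases hg0 : g = 0
    · simp [hg0]
    have hd : g.natDegree + 2 ≤ n := by
      have h1 := congrArg natDegree hg
      rw [natDegree_sub_C, natDegree_mul (X_sub_C_ne_zero 1) hg0, natDegree_X_sub_C] at h1
      omega
    have hd' : (-g).natDegree + 2 ≤ n := by rwa [natDegree_neg]
    have d1 : ((1 - X) * (-g)).natDegree < n := by
      have h1 : (1 - X : ℝ[X]).natDegree ≤ 1 := by compute_degree
      have h2 := natDegree_mul_le (p := (1 - X : ℝ[X])) (q := -g)
      omega
    have e : Y * ((1 - X) * (-g)) = p * ((1 - X) * (-g)) -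
        (N * κ) • (jacobiCorrection α β n * ((1 - X) * (-g))) := by
      rw [smul_eq_C_mul, hY]; ring
    rw [e, map_sub, map_smul, jacobiMean_jacobiPoly_mul hα hβ n d1,
      jacobiMean_jacobiCorrection_mul hα hβ hd']
    simp
  have e : Y * f = (f.eval 1) • Y + Y * ((1 - X) * (-g)) := by
    rw [smul_eq_C_mul]; nth_rw 1 [hf2]; ring
  rw [e, map_add, map_smul, z2, smul_eq_mul, eval_add, eval_smul, smul_eq_mul]
  simp only [eval_mul, eval_sub, eval_one, eval_X, sub_self, zero_mul, mul_zero, add_zero]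
  linear_combination (f.eval 1) * z1

end

theorem IsGenJacobi.exists_eq_C_mul {α β : ℝ} (hα : -1 < α) (hβ : -1 < β) {N : ℝ} (hN : 0 ≤ N)
    {P : ℕ → ℝ[X]} (hP : IsGenJacobi α β 0 N P) {n : ℕ} {Y : ℝ[X]} (hYd : Y.natDegree ≤ n)
    (hY0 : Y ≠ 0)
    (hY : ∀ f : ℝ[X], f.degree < n → jacobiMean hα hβ (Y * f) + N * (Y * f).eval 1 = 0) :
    ∃ c : ℝ, P n = C c * Y := by
  have hlow : ∀ d : ℕ, d ≤ n → ∀ f : ℝ[X], f.degree < d →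
      jacobiMean hα hβ (P n * f) + N * (P n * f).eval 1 = 0 := by
    intro d
    induction d with
    | zero =>
      intro _ f hf
      obtain rfl : f = 0 := by
        rw [← degree_eq_bot, ← Nat.WithBot.lt_zero_iff]; exact_mod_cast hf
      simp
    | succ d ih =>
      intro hd f hf
      have hPd := hP.degree_eq d
      have hlc : (P d).coeff d ≠ 0 := coeff_ne_zero_of_eq_degree hPd
      set r := f.coeff d / (P d).coeff d with hr
      have hg : (f - C r * P d).degree < d := by
        rw [degree_lt_iff_coeff_zero]
        intro m hm
        rcases hm.eq_or_lt with rfl | hm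
        · rw [coeff_sub, coeff_C_mul, hr]
          field_simp
          ring
        · rw [coeff_sub, coeff_C_mul, coeff_eq_zero_of_degree_lt (hf.trans_le (by exact_mod_cast hm)),
            coeff_eq_zero_of_degree_lt (by rw [hPd]; exact_mod_cast hm)]
          ring
      have h1 := ih (by omega) _ hg
      have h2 := hP.orthogonal n d (by omega)
      rw [genJacobiInner_eq hα hβ] at h2
      have e : P n * f = P n * (f - C r * P d) + r • (P n * P d) := by
        rw [smul_eq_C_mul]; ring
      rw [e, map_add, map_smul, eval_add, eval_smul, smul_eq_mul, smul_eq_mul]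
      linear_combination h1 + r * h2
  have hPn := hP.degree_eq n
  have hlc : (P n).coeff n ≠ 0 := coeff_ne_zero_of_eq_degree hPn
  set s := Y.coeff n / (P n).coeff n with hs
  have hg : (Y - C s * P n).degree < n := by
    rw [degree_lt_iff_coeff_zero]
    intro m hm
    rcases hm.eq_or_lt with rfl | hm
    · rw [coeff_sub, coeff_C_mul, hs]
      field_simp
      ring
    · rw [coeff_sub, coeff_C_mul, coeff_eq_zero_of_natDegree_lt (by omega),
        coeff_eq_zero_of_degree_lt (by rw [hPn]; exact_mod_cast hm)]
      ring
  have hz : Y - C s * P n = 0 := by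
    by_contra h0
    have h1 := hY _ hg
    have h2 := hlow n le_rfl _ hg
    have h3 := jacobiMean_mul_self_pos hα hβ h0
    have e : (Y - C s * P n) * (Y - C s * P n) = Y * (Y - C s * P n) -
        s • (P n * (Y - C s * P n)) := by
      rw [smul_eq_C_mul]; ring
    have h4 : 0 ≤ N * ((Y - C s * P n) * (Y - C s * P n)).eval 1 := by
      rw [eval_mul]; exact mul_nonneg hN (mul_self_nonneg _)
    have h5 : jacobiMean hα hβ ((Y - C s * P n) * (Y - C s * P n)) +
        N * ((Y - C s * P n) * (Y - C s * P n)).eval 1 = 0 := by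
      rw [e, map_sub, map_smul, eval_sub, eval_smul, smul_eq_mul, smul_eq_mul]
      linear_combination h1 - s * h2
    linarith
  have hs0 : s ≠ 0 := by
    rintro h
    rw [h, C_0, zero_mul, sub_zero] at hz
    exact hY0 hz
  refine ⟨s⁻¹, ?_⟩
  rw [sub_eq_zero.1 hz, ← mul_assoc, ← C_mul, inv_mul_cancel₀ hs0, C_1, one_mul]

/-! ### The two quadratic transformations -/

theorem Ring.choose_add_eq_ascPochhammer_div (z : ℝ) (k : ℕ) :
    Ring.choose (k + z) k = (ascPochhammer ℝ k).eval (z + 1) / (k.factorial : ℝ) := by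
  induction k with
  | zero => simp
  | succ k ih =>
    have h := Ring.succ_mul_choose_succ' (k + 1 + z) k
    rw [show (k : ℝ) + 1 + z - 1 = k + z by ring, ih] at h
    have h1 : (k : ℝ) + 1 ≠ 0 := by positivity
    have h2 : (k.factorial : ℝ) ≠ 0 := by positivity
    apply mul_left_cancel₀ h1
    rw [ascPochhammer_succ_eval, Nat.factorial_succ]
    push_cast
    rw [h]
    field_simp
    ring

/-- The constant of the orthogonality relation for `β = -1/2`. -/
theorem massConst_neg_half (a : ℝ) (m : ℕ) :
    4 * (Ring.choose ((2 * m : ℕ) + 2 * a) (2 * m) / (((2 * m : ℕ) + 1) * ((2 * m : ℕ) + 2))) * a *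
      ((m + 1).factorial * ((m + 1 : ℕ) + a - 1 / 2) * (ascPochhammer ℝ (m + 1)).eval (1 / 2)) =
      (ascPochhammer ℝ (m + 1)).eval a * (ascPochhammer ℝ (m + 1)).eval (a + 1 / 2) := by
  have h1 := ascPochhammer_two_mul a (m + 1)
  have h2 := factorial_two_mul_eq_ascPochhammer (m + 1)
  rw [show 2 * (m + 1) = 2 * m + 1 + 1 by ring, ascPochhammer_succ_left_eval,
    ascPochhammer_succ_eval] at h1
  have h4 : ((2 * (m + 1)).factorial : ℝ) = ((2 * m).factorial : ℝ) * (2 * m + 1) * (2 * m + 2) := by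
    rw [show 2 * (m + 1) = 2 * m + 1 + 1 by ring, Nat.factorial_succ, Nat.factorial_succ]
    push_cast
    ring
  rw [h4] at h2
  rw [Ring.choose_add_eq_ascPochhammer_div]
  have h5 : ((2 * m).factorial : ℝ) ≠ 0 := by positivity
  have h7 : (4 : ℝ) ^ (m + 1) ≠ 0 := by positivity
  apply mul_left_cancel₀ h7
  rw [← mul_assoc (4 ^ (m + 1) : ℝ) ((ascPochhammer ℝ (m + 1)).eval a), ← h1]
  have h8 : (4 : ℝ) ^ (m + 1) * (4 * ((ascPochhammer ℝ (2 * m)).eval (2 * a + 1) /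
      ((2 * m).factorial : ℝ) / (((2 * m : ℕ) + 1) * ((2 * m : ℕ) + 2))) * a *
      ((m + 1).factorial * ((m + 1 : ℕ) + a - 1 / 2) * (ascPochhammer ℝ (m + 1)).eval (1 / 2))) =
      4 * ((ascPochhammer ℝ (2 * m)).eval (2 * a + 1) /
      (((2 * m).factorial : ℝ) * ((2 * m) + 1) * ((2 * m) + 2))) * a * (m + a + 1 / 2) *
      (4 ^ (m + 1) * (m + 1).factorial * (ascPochhammer ℝ (m + 1)).eval (1 / 2)) := by
    push_cast
    field_simp
    ring
  rw [h8, ← h2]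
  push_cast
  field_simp
  ring

/-- The constant of the orthogonality relation for `β = 1/2`. -/
theorem massConst_half {a : ℝ} (ha : 0 < a) (m : ℕ) :
    4 * (Ring.choose ((2 * m + 1 : ℕ) + 2 * a) (2 * m + 1) /
      (((2 * m + 1 : ℕ) + 1) * ((2 * m + 1 : ℕ) + 2))) / (2 * a + 1) * a *
      ((m + 1).factorial * ((m + 1 : ℕ) + a + 1 / 2) * (ascPochhammer ℝ (m + 1)).eval (3 / 2)) =
      (ascPochhammer ℝ (m + 1)).eval a * (ascPochhammer ℝ (m + 1)).eval (a + 3 / 2) := by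
  have h1 := ascPochhammer_two_mul a (m + 1)
  have h2 := factorial_two_mul_eq_ascPochhammer (m + 1)
  have shift : ∀ x : ℝ, x * (ascPochhammer ℝ (m + 1)).eval (x + 1) =
      (ascPochhammer ℝ (m + 1)).eval x * (x + (m + 1)) := by
    intro x
    rw [← ascPochhammer_succ_left_eval, ascPochhammer_succ_eval]
    push_cast
    ring
  have s1 := shift (1 / 2)
  have s2 := shift (a + 1 / 2)
  rw [show (1 / 2 + 1 : ℝ) = 3 / 2 by norm_num] at s1
  rw [show a + 1 / 2 + 1 = a + 3 / 2 by ring] at s2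
  rw [show 2 * (m + 1) = 2 * m + 1 + 1 by ring, ascPochhammer_succ_left_eval] at h1
  have h4 : ((2 * (m + 1)).factorial : ℝ) = ((2 * m + 1).factorial : ℝ) * (2 * m + 2) := by
    rw [show 2 * (m + 1) = 2 * m + 1 + 1 by ring, Nat.factorial_succ]
    push_cast
    ring
  rw [h4] at h2
  rw [Ring.choose_add_eq_ascPochhammer_div]
  have h5 : ((2 * m + 1).factorial : ℝ) ≠ 0 := by positivity
  have h6 : 2 * a + 1 ≠ 0 := by positivity
  have h7 : (4 : ℝ) ^ (m + 1) * (a + 1 / 2) ≠ 0 := by positivity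
  apply mul_left_cancel₀ h7
  have e1 : (4 : ℝ) ^ (m + 1) * (a + 1 / 2) * ((ascPochhammer ℝ (m + 1)).eval a *
      (ascPochhammer ℝ (m + 1)).eval (a + 3 / 2)) =
      2 * a * (ascPochhammer ℝ (2 * m + 1)).eval (2 * a + 1) * (a + 1 / 2 + (m + 1)) := by
    linear_combination (4 : ℝ) ^ (m + 1) * (ascPochhammer ℝ (m + 1)).eval a * s2 -
      (a + 1 / 2 + (m + 1)) * h1
  have e2 : (4 : ℝ) ^ (m + 1) * (m + 1).factorial * (ascPochhammer ℝ (m + 1)).eval (3 / 2) =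
      ((2 * m + 1).factorial : ℝ) * (2 * m + 2) * (2 * m + 3) := by
    linear_combination 2 * (4 : ℝ) ^ (m + 1) * (m + 1).factorial * s1 - (2 * m + 3) * h2
  rw [e1]
  have h8 : (4 : ℝ) ^ (m + 1) * (a + 1 / 2) *
      (4 * ((ascPochhammer ℝ (2 * m + 1)).eval (2 * a + 1) /
      ((2 * m + 1).factorial : ℝ) / (((2 * m + 1 : ℕ) + 1) * ((2 * m + 1 : ℕ) + 2))) / (2 * a + 1) *
      a * ((m + 1).factorial * ((m + 1 : ℕ) + a + 1 / 2) *
        (ascPochhammer ℝ (m + 1)).eval (3 / 2))) =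
      2 * ((ascPochhammer ℝ (2 * m + 1)).eval (2 * a + 1) /
      (((2 * m + 1).factorial : ℝ) * ((2 * m) + 2) * ((2 * m) + 3))) * a * (m + a + 3 / 2) *
      (4 ^ (m + 1) * (m + 1).factorial * (ascPochhammer ℝ (m + 1)).eval (3 / 2)) := by
    push_cast
    rw [show (2 * (m : ℝ) + 1 + 1) = 2 * m + 2 by ring, show (2 * (m : ℝ) + 1 + 2) = 2 * m + 3 by ring]
    field_simp
    ring
  rw [h8, e2]
  field_simp
  ring

theorem ultraOp_comp (α : ℝ) (y : ℝ[X]) :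
    ultraOp α (y.comp (2 * X ^ 2 - 1)) =
      C (-4) * (jacobiOp α (-1 / 2) y).comp (2 * X ^ 2 - 1) := by
  rw [ultraOp, jacobiOp]
  simp only [derivative_comp, derivative_mul, derivative_sub, derivative_X_pow, derivative_one,
    derivative_ofNat, derivative_zero]
  refine funext fun x => ?_
  simp
  ring

theorem ultraOp_X_mul_comp (α : ℝ) (y : ℝ[X]) :
    ultraOp α (X * y.comp (2 * X ^ 2 - 1)) =
      X * (C (-4) * (jacobiOp α (1 / 2) y).comp (2 * X ^ 2 - 1) +
        C (2 * α + 2) * y.comp (2 * X ^ 2 - 1)) := by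
  rw [ultraOp, jacobiOp]
  simp only [derivative_comp, derivative_mul, derivative_sub, derivative_X_pow, derivative_one,
    derivative_ofNat, derivative_zero, derivative_X, derivative_add]
  refine funext fun x => ?_
  simp
  ring

theorem X_sq_sub_one_mul_derivative_comp (α : ℝ) (n : ℕ) :
    (X ^ 2 - 1) * derivative (derivative ((jacobiPoly α (-1 / 2) n).comp (2 * X ^ 2 - 1))) =
      C (-4) * (jacobiCorrection α (-1 / 2) n).comp (2 * X ^ 2 - 1) := by
  rw [jacobiCorrection]
  simp only [derivative_comp, derivative_mul, derivative_sub, derivative_X_pow, derivative_one,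
    derivative_ofNat, derivative_zero]
  refine funext fun x => ?_
  simp
  ring

theorem X_sq_sub_one_mul_derivative_X_mul_comp (α : ℝ) (n : ℕ) :
    (X ^ 2 - 1) * derivative (derivative (X * (jacobiPoly α (1 / 2) n).comp (2 * X ^ 2 - 1))) =
      C (-4) * (X * (jacobiCorrection α (1 / 2) n).comp (2 * X ^ 2 - 1)) := by
  rw [jacobiCorrection]
  simp only [derivative_comp, derivative_mul, derivative_sub, derivative_X_pow, derivative_one,
    derivative_ofNat, derivative_zero, derivative_X, derivative_add]
  refine funext fun x => ?_
  simp
  ring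

theorem natDegree_two_mul_X_sq_sub_one : (2 * X ^ 2 - 1 : ℝ[X]).natDegree = 2 := by
  rw [show (2 : ℝ[X]) = C 2 from (map_ofNat C 2).symm]
  compute_degree!

theorem eq_zero_of_comp_eq_zero {p : ℝ[X]} (h : p.comp (2 * X ^ 2 - 1) = 0) : p = 0 := by
  rcases comp_eq_zero_iff.1 h with h | ⟨_, h⟩
  · exact h
  · have := natDegree_two_mul_X_sq_sub_one
    rw [h, natDegree_C] at this
    omega

theorem natDegree_jacobiCorrection_le {α β : ℝ} (hβ : -1 < β) (n : ℕ) :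
    (jacobiCorrection α β n).natDegree ≤ n := by
  have h0 := natDegree_jacobiPoly_le α β n
  rw [jacobiCorrection_eq α hβ]
  refine (natDegree_sub_le _ _).trans (max_le ?_ ((natDegree_C_mul_le _ _).trans h0))
  rw [mul_assoc]
  refine (natDegree_C_mul_le _ _).trans ?_
  rcases Nat.eq_zero_or_pos n with rfl | hn
  · rw [derivative_of_natDegree_zero (by omega)]
    simp
  · refine natDegree_mul_le.trans ?_
    have h1 : (1 + X : ℝ[X]).natDegree ≤ 1 := by compute_degree
    have h2 := natDegree_derivative_le (jacobiPoly α β n)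
    omega

/-- Every orthogonal polynomial for the Jacobi weight with an additional mass at `1` is a multiple
of the explicit one. -/
theorem IsGenJacobi.exists_eq_jacobiPoly_sub {α β : ℝ} (hα : -1 < α) (hβ : -1 < β) {N : ℝ}
    (hN : 0 ≤ N) {P : ℕ → ℝ[X]} (hP : IsGenJacobi α β 0 N P) {n : ℕ} {κ : ℝ}
    (hκ : κ * (α + 1) * (n.factorial * (n + α + β + 1) * (ascPochhammer ℝ n).eval (β + 1)) =
      (ascPochhammer ℝ n).eval (α + 1) * (ascPochhammer ℝ n).eval (α + β + 2)) :
    ∃ c : ℝ, P n = C c * (jacobiPoly α β n - C (N * κ) * jacobiCorrection α β n) := by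
  refine hP.exists_eq_C_mul hα hβ hN ?_ ?_ fun f hf =>
    jacobiMean_add_eval_one_eq_zero hα hβ N κ hκ hf
  · exact (natDegree_sub_le _ _).trans (max_le (natDegree_jacobiPoly_le α β n)
      ((natDegree_C_mul_le _ _).trans (natDegree_jacobiCorrection_le hβ n)))
  · intro h
    have h1 := congrArg (eval 1) h
    have h2 : (ascPochhammer ℝ n).eval (β + 1) ≠ 0 := (ascPochhammer_pos n _ (by linarith)).ne'
    have h3 : (ascPochhammer ℝ n).eval (α + 1) ≠ 0 := (ascPochhammer_pos n _ (by linarith)).ne'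
    rw [eval_sub, eval_mul, jacobiPoly_eval_one hβ] at h1
    simp [jacobiCorrection, h2, h3] at h1

theorem sub_C_mul_eq_add (p q : ℝ[X]) {u v : ℝ} (h : u = 4 * v) :
    p - C u * q = p + C v * (C (-4) * q) := by
  rw [h, C_mul, C_neg]
  ring

/-- The ultraspherical equation perturbed by `M ∑ cᵢ ∂ⁱ` and its eigenvalue. -/
def SatisfiesPerturbed (α M τ μ : ℝ) (Y : ℝ[X]) : Prop :=
  C M * (C (2 * α + 3) * (1 - X ^ 2) * quadOp (α + 1) 2 Y + C (4 * (2 * α + 3) * τ) * Y) -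
    ultraOp α Y + C μ * Y = 0

theorem SatisfiesPerturbed.C_mul {α M τ μ : ℝ} {Y : ℝ[X]} (h : SatisfiesPerturbed α M τ μ Y)
    (c : ℝ) : SatisfiesPerturbed α M τ μ (C c * Y) := by
  rw [SatisfiesPerturbed] at *
  rw [quadOp_C_mul, ultraOp_C_mul]
  linear_combination (C c) * h

theorem satisfiesPerturbed_of_ultraOp {α : ℝ} (hα : -1 < α) {k : ℕ} {f : ℝ[X]}
    (hf : f.natDegree ≤ k + 2)
    (hJ : ultraOp α f = C ((k + 2) * (k + 2 * α + 3)) * f) (M : ℝ) :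
    SatisfiesPerturbed α M (Ring.choose (k + 2 * α + 4) k) ((k + 2) * (k + 2 * α + 3))
      (f + C (2 * M * (Ring.choose (k + 2 * (α + 1)) k / ((k + 1) * (k + 2)))) *
        ((X ^ 2 - 1) * derivative (derivative f))) := by
  have h := perturbed_ultraspherical_equation (a := α + 1) (by linarith) hf
    (by rw [add_sub_cancel_right, hJ]; congr 2; ring) M rfl
  rw [add_sub_cancel_right, show 2 * (α + 1) + 1 = 2 * α + 3 by ring,
    show (k : ℝ) + 2 * (α + 1 + 1) = k + 2 * α + 4 by ring,
    show (k : ℝ) + 2 * (α + 1) + 1 = k + 2 * α + 3 by ring] at h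
  exact h

theorem IsGenJacobi.satisfiesPerturbed_comp {α : ℝ} (hα : -1 < α) {N : ℝ} (hN : 0 ≤ N)
    {P : ℕ → ℝ[X]} (hP : IsGenJacobi α (-1 / 2) 0 N P) (n : ℕ) :
    SatisfiesPerturbed α (N / 2) (binom (2 * n + 2 * α + 2) (2 * (n : ℤ) - 2))
      (2 * n * (2 * n + 2 * α + 1)) ((P n).comp (2 * X ^ 2 - 1)) := by
  cases n with
  | zero =>
    have h0 : (P 0) = C ((P 0).coeff 0) :=
      eq_C_of_degree_le_zero (by rw [hP.degree_eq 0]; rfl)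
    rw [h0, C_comp, SatisfiesPerturbed, quadOp_eq_zero _ _ (by simp)]
    simp [ultraOp, binom]
  | succ m =>
    have hβ : (-1 : ℝ) < -1 / 2 := by norm_num
    obtain ⟨c, hc⟩ := hP.exists_eq_jacobiPoly_sub hα hβ hN (n := m + 1)
      (κ := 4 * (Ring.choose ((2 * m : ℕ) + 2 * (α + 1)) (2 * m) /
        (((2 * m : ℕ) + 1) * ((2 * m : ℕ) + 2)))) (by
        have := massConst_neg_half (α + 1) m
        rw [show ((m + 1 : ℕ) : ℝ) + α + -1 / 2 + 1 = (m + 1 : ℕ) + (α + 1) - 1 / 2 by ring,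
          show (-1 / 2 + 1 : ℝ) = 1 / 2 by norm_num, show α + -1 / 2 + 2 = α + 1 + 1 / 2 by ring]
        exact this)
    rw [hc, mul_comp, C_comp]
    refine SatisfiesPerturbed.C_mul ?_ c
    have hJ : ultraOp α ((jacobiPoly α (-1 / 2) (m + 1)).comp (2 * X ^ 2 - 1)) =
        C (((2 * m : ℕ) + 2) * ((2 * m : ℕ) + 2 * α + 3)) *
          (jacobiPoly α (-1 / 2) (m + 1)).comp (2 * X ^ 2 - 1) := by
      rw [ultraOp_comp, jacobiPoly_ode α hβ, mul_comp, neg_comp, C_comp, ← C_neg, ← mul_assoc,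
        ← C_mul]
      congr 2
      push_cast
      ring
    have hd : ((jacobiPoly α (-1 / 2) (m + 1)).comp (2 * X ^ 2 - 1)).natDegree ≤ 2 * m + 2 := by
      refine natDegree_comp_le.trans ?_
      have := natDegree_jacobiPoly_le α (-1 / 2) (m + 1)
      rw [natDegree_two_mul_X_sq_sub_one]
      omega
    have h := satisfiesPerturbed_of_ultraOp hα hd hJ (N / 2)
    rw [X_sq_sub_one_mul_derivative_comp] at h
    rw [show 2 * ((m + 1 : ℕ) : ℤ) - 2 = ((2 * m : ℕ) : ℤ) by push_cast; ring, binom_natCast]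
    convert h using 1
    · congr 1; push_cast; ring
    · push_cast; ring
    · rw [sub_comp, mul_comp, C_comp]
      exact sub_C_mul_eq_add _ _ (by ring)

theorem IsGenJacobi.satisfiesPerturbed_X_mul_comp {α : ℝ} (hα : -1 < α) {N : ℝ} (hN : 0 ≤ N)
    {P : ℕ → ℝ[X]} (hP : IsGenJacobi α (1 / 2) 0 N P) (n : ℕ) :
    SatisfiesPerturbed α (N / (2 * (2 * α + 3))) (binom (2 * n + 2 * α + 3) (2 * (n : ℤ) - 1))
      ((2 * n + 1) * (2 * n + 2 * α + 2)) (X * (P n).comp (2 * X ^ 2 - 1)) := by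
  cases n with
  | zero =>
    have h0 : (P 0) = C ((P 0).coeff 0) :=
      eq_C_of_degree_le_zero (by rw [hP.degree_eq 0]; rfl)
    rw [h0, C_comp, SatisfiesPerturbed, quadOp_eq_zero _ _ (by
      refine lt_of_le_of_lt natDegree_mul_le ?_
      simp)]
    simp [ultraOp, binom]
    ring
  | succ m =>
    have hβ : (-1 : ℝ) < 1 / 2 := by norm_num
    have h3 : 2 * α + 3 ≠ 0 := by linarith
    obtain ⟨c, hc⟩ := hP.exists_eq_jacobiPoly_sub hα hβ hN (n := m + 1)
      (κ := 4 * (Ring.choose ((2 * m + 1 : ℕ) + 2 * (α + 1)) (2 * m + 1) /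
        (((2 * m + 1 : ℕ) + 1) * ((2 * m + 1 : ℕ) + 2))) / (2 * (α + 1) + 1)) (by
        have := massConst_half (a := α + 1) (by linarith) m
        rw [show ((m + 1 : ℕ) : ℝ) + α + 1 / 2 + 1 = (m + 1 : ℕ) + (α + 1) + 1 / 2 by ring,
          show (1 / 2 + 1 : ℝ) = 3 / 2 by norm_num, show α + 1 / 2 + 2 = α + 1 + 3 / 2 by ring]
        exact this)
    rw [hc, mul_comp, C_comp, mul_left_comm]
    refine SatisfiesPerturbed.C_mul ?_ c
    have hJ : ultraOp α (X * (jacobiPoly α (1 / 2) (m + 1)).comp (2 * X ^ 2 - 1)) =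
        C (((2 * m + 1 : ℕ) + 2) * ((2 * m + 1 : ℕ) + 2 * α + 3)) *
          (X * (jacobiPoly α (1 / 2) (m + 1)).comp (2 * X ^ 2 - 1)) := by
      rw [ultraOp_X_mul_comp, jacobiPoly_ode α hβ, mul_comp, neg_comp, C_comp, ← C_neg,
        ← mul_assoc, ← C_mul, ← add_mul, ← C_add, mul_left_comm]
      congr 2
      push_cast
      ring
    have hd : (X * (jacobiPoly α (1 / 2) (m + 1)).comp (2 * X ^ 2 - 1)).natDegree ≤
        2 * m + 1 + 2 := by
      have h1 := natDegree_mul_le (p := (X : ℝ[X]))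
        (q := (jacobiPoly α (1 / 2) (m + 1)).comp (2 * X ^ 2 - 1))
      have h2 := natDegree_comp (p := jacobiPoly α (1 / 2) (m + 1)) (q := 2 * X ^ 2 - 1)
      have h4 := natDegree_jacobiPoly_le α (1 / 2) (m + 1)
      rw [natDegree_two_mul_X_sq_sub_one] at h2
      rw [natDegree_X] at h1
      omega
    have h := satisfiesPerturbed_of_ultraOp hα hd hJ (N / (2 * (2 * α + 3)))
    rw [X_sq_sub_one_mul_derivative_X_mul_comp] at h
    rw [show 2 * ((m + 1 : ℕ) : ℤ) - 1 = ((2 * m + 1 : ℕ) : ℤ) by push_cast; ring, binom_natCast]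
    convert h using 1
    · congr 1; push_cast; ring
    · push_cast; ring
    · rw [sub_comp, mul_comp, C_comp, mul_sub, mul_left_comm]
      refine sub_C_mul_eq_add _ _ ?_
      rw [show 2 * (α + 1) + 1 = 2 * α + 3 by ring]
      field_simp

/-! ### The differential equations -/

theorem seriesOp_withZeroth (a : ℝ) {d : ℕ → ℝ[X]} (hd : d 0 = 0) {y : ℝ[X]} {J : ℕ}
    (hJ : y.natDegree < J) (t : ℝ) :
    seriesOp (withZeroth a d) y t = a * y.eval t +
      ∑ j ∈ Finset.range J, (d j).eval t * (derivative^[j] y).eval t := by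
  have hJ0 : J = (J - 1) + 1 := by omega
  rw [seriesOp, tsum_eq_sum (s := Finset.range J), hJ0, Finset.sum_range_succ',
    Finset.sum_range_succ', hd, withZeroth]
  · simp only [withZeroth]
    simp
    ring
  · intro j hj
    rw [Finset.mem_range] at hj
    rw [iterate_derivative_eq_zero (by omega), eval_zero, mul_zero]

theorem eval_eq_zero_of_forall_comp {E : ℝ[X]}
    (h : ∀ x : ℝ, x ≠ 0 → E.eval (2 * x ^ 2 - 1) = 0) (t : ℝ) : E.eval t = 0 := by
  have h1 : X * E.comp (2 * X ^ 2 - 1) = 0 := by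
    refine funext fun x => ?_
    rcases eq_or_ne x 0 with rfl | hx
    · simp
    · have := h x hx
      simp [this]
  rw [eq_zero_of_comp_eq_zero ((mul_eq_zero.1 h1).resolve_left X_ne_zero), eval_zero]

theorem differential_equation_neg_half {α N τ : ℝ} {n : ℕ} {δ : ℕ → ℝ[X]}
    (hδ : ∀ j, dPoly α j = (δ j).comp (2 * X ^ 2 - 1)) {y : ℝ[X]}
    (hy : SatisfiesPerturbed α (N / 2) τ (2 * n * (2 * n + 2 * α + 1))
      (y.comp (2 * X ^ 2 - 1))) (t : ℝ) :
    N * seriesOp (withZeroth (1 / 2 * (2 * α + 3) * τ) fun j => C (1 / 8) * δ j) y t +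
      (1 - t ^ 2) * (derivative (derivative y)).eval t -
      1 / 2 * ((2 * α + 1) + (2 * α + 3) * t) * (derivative y).eval t +
      1 / 2 * n * (2 * n + 2 * α + 1) * y.eval t = 0 := by
  have hJ : y.natDegree < y.natDegree + 1 := by omega
  have h0 : (C (1 / 8) * δ 0 : ℝ[X]) = 0 := by
    have : δ 0 = 0 := eq_zero_of_comp_eq_zero (by rw [← hδ]; simp [dPoly, cPoly])
    rw [this, mul_zero]
  have key := eval_eq_zero_of_forall_comp (E := C N * (C (1 / 2 * (2 * α + 3) * τ) * y +
      ∑ j ∈ Finset.range (y.natDegree + 1), C (1 / 8) * δ j * derivative^[j] y) +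
      jacobiOp α (-1 / 2) y + C (1 / 2 * n * (2 * n + 2 * α + 1)) * y) (fun x _ => ?_) t
  · rw [seriesOp_withZeroth _ h0 hJ]
    rw [jacobiOp] at key
    simp only [eval_add, eval_mul, eval_C, eval_finsetSum, eval_sub, eval_X, eval_pow,
      eval_one] at key ⊢
    linear_combination key
  · have h1 := sum_dPoly_mul α y hJ x
    have h2 := congrArg (fun p => p.eval x) hy
    rw [ultraOp_comp] at h2
    simp only [hδ, eval_comp] at h1
    simp only [eval_add, eval_mul, eval_C, eval_finsetSum, eval_sub, eval_X, eval_pow,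
      eval_one, eval_comp, eval_zero, eval_ofNat] at h1 h2 ⊢
    simp only [mul_assoc (1 / 8 : ℝ), ← Finset.mul_sum, h1]
    linear_combination (1 / 4) * h2

theorem differential_equation_half {α N τ : ℝ} (hα : -1 < α) {n : ℕ} {δ : ℕ → ℝ[X]}
    (hδ : ∀ j, xePoly α j = X * (δ j).comp (2 * X ^ 2 - 1)) {y : ℝ[X]}
    (hy : SatisfiesPerturbed α (N / (2 * (2 * α + 3))) τ ((2 * n + 1) * (2 * n + 2 * α + 2))
      (X * y.comp (2 * X ^ 2 - 1))) (t : ℝ) :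
    N * seriesOp (withZeroth (1 / 2 * τ) fun j => C (1 / (8 * (2 * α + 3))) * δ j) y t +
      (1 - t ^ 2) * (derivative (derivative y)).eval t -
      1 / 2 * ((2 * α - 1) + (2 * α + 5) * t) * (derivative y).eval t +
      1 / 2 * n * (2 * n + 2 * α + 3) * y.eval t = 0 := by
  have hJ : y.natDegree < y.natDegree + 1 := by omega
  have h3 : 2 * α + 3 ≠ 0 := by linarith
  have h0 : (C (1 / (8 * (2 * α + 3))) * δ 0 : ℝ[X]) = 0 := by
    have h1 : X * (δ 0).comp (2 * X ^ 2 - 1) = 0 := by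
      rw [← hδ, xePoly]
      refine Finset.sum_eq_zero fun i hi => ?_
      have hi := Finset.mem_Icc.1 hi
      obtain rfl | rfl : i = 0 ∨ i = 1 := by omega
      · simp [cPoly]
      · simp [cPoly]
    rw [eq_zero_of_comp_eq_zero ((mul_eq_zero.1 h1).resolve_left X_ne_zero), mul_zero]
  have key := eval_eq_zero_of_forall_comp (E := C N * (C (1 / 2 * τ) * y +
      ∑ j ∈ Finset.range (y.natDegree + 1), C (1 / (8 * (2 * α + 3))) * δ j * derivative^[j] y) +
      jacobiOp α (1 / 2) y + C (1 / 2 * n * (2 * n + 2 * α + 3)) * y) (fun x hx => ?_) t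
  · rw [seriesOp_withZeroth _ h0 hJ]
    rw [jacobiOp] at key
    simp only [eval_add, eval_mul, eval_C, eval_finsetSum, eval_sub, eval_X, eval_pow,
      eval_one] at key ⊢
    linear_combination key
  · have h1 := sum_xePoly_mul α y hJ x
    have h2 := congrArg (fun p => p.eval x) hy
    rw [ultraOp_X_mul_comp] at h2
    simp only [hδ, eval_comp, eval_mul, eval_X, mul_assoc x] at h1
    rw [← Finset.mul_sum] at h1
    simp only [eval_add, eval_mul, eval_C, eval_finsetSum, eval_sub, eval_X, eval_pow,
      eval_one, eval_comp, eval_zero, eval_ofNat] at h1 h2 ⊢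
    simp only [mul_assoc (1 / (8 * (2 * α + 3)) : ℝ), ← Finset.mul_sum]
    apply mul_left_cancel₀ hx
    set S := ∑ j ∈ Finset.range (y.natDegree + 1),
      (δ j).eval (2 * x ^ 2 - 1) * (derivative^[j] y).eval (2 * x ^ 2 - 1)
    rw [← h1] at h2
    have h4 : N / (2 * (2 * α + 3)) * (4 * (2 * α + 3) * τ) = 2 * N * τ := by
      field_simp
      ring
    have h5 : 1 / (8 * (2 * α + 3)) = 1 / 4 * (1 / (2 * (2 * α + 3))) := by
      field_simp
      ring
    rw [h5]
    linear_combination (1 / 4) * h2 - (1 / 4) * (x * y.eval (2 * x ^ 2 - 1)) * h4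

theorem eval_sqrt_two_mul_X_sq_sub_one {t : ℝ} (ht : -1 ≤ t) :
    (2 * X ^ 2 - 1 : ℝ[X]).eval (Real.sqrt ((1 + t) / 2)) = t := by
  simp only [eval_sub, eval_mul, eval_ofNat, eval_pow, eval_X, eval_one]
  rw [Real.sq_sqrt (by linarith)]
  ring

end

theorem mainTheorem5 (α : ℝ) (hα : -1 < α) :
    -- the case `β = -1/2`
    (∃ d : ℕ → ℝ[X],
      (∀ j : ℕ, 1 ≤ j → (d j).natDegree ≤ j ∧
        ∀ t : ℝ, -1 ≤ t → (d j).eval t = 1 / 8 * dCoeff α j (Real.sqrt ((1 + t) / 2))) ∧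
      (∀ N : ℝ, 0 ≤ N → ∀ P : ℕ → ℝ[X], IsGenJacobi α (-1 / 2) 0 N P → ∀ (n : ℕ) (t : ℝ),
        N * seriesOp (withZeroth (1 / 2 * (2 * α + 3) *
              binom (2 * n + 2 * α + 2) (2 * (n : ℤ) - 2)) d) (P n) t
          + (1 - t ^ 2) * (derivative (derivative (P n))).eval t
          - 1 / 2 * ((2 * α + 1) + (2 * α + 3) * t) * (derivative (P n)).eval t
          + 1 / 2 * n * (2 * n + 2 * α + 1) * (P n).eval t = 0) ∧
      (∀ N : ℝ, 0 < N → ∀ n : ℕ, ∀ A : ℕ → ℝ[X],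
        A = eqCoeff N
            (withZeroth (1 / 2 * (2 * α + 3) *
              binom (2 * n + 2 * α + 2) (2 * (n : ℤ) - 2)) d)
            (1 - X ^ 2)
            (-(C (1 / 2) * (C (2 * α + 1) + C (2 * α + 3) * X)))
            (C (1 / 2 * n * (2 * n + 2 * α + 1))) →
          ((¬ ∃ k : ℕ, α = k) → diffOrder A = ⊤) ∧
          (∀ k : ℕ, α = k → diffOrder A = ((2 * k + 4 : ℕ) : ℕ∞)))) ∧
    -- the case `β = 1/2`
    (∃ e : ℕ → ℝ[X],
      (∀ j : ℕ, 1 ≤ j → (e j).natDegree ≤ j ∧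
        ∀ t : ℝ, -1 < t → (e j).eval t =
          1 / (8 * (2 * α + 3)) * eCoeff α j (Real.sqrt ((1 + t) / 2))) ∧
      (∀ N : ℝ, 0 ≤ N → ∀ P : ℕ → ℝ[X], IsGenJacobi α (1 / 2) 0 N P → ∀ (n : ℕ) (t : ℝ),
        N * seriesOp (withZeroth (1 / 2 *
              binom (2 * n + 2 * α + 3) (2 * (n : ℤ) - 1)) e) (P n) t
          + (1 - t ^ 2) * (derivative (derivative (P n))).eval t
          - 1 / 2 * ((2 * α - 1) + (2 * α + 5) * t) * (derivative (P n)).eval t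
          + 1 / 2 * n * (2 * n + 2 * α + 3) * (P n).eval t = 0) ∧
      (∀ N : ℝ, 0 < N → ∀ n : ℕ, ∀ A : ℕ → ℝ[X],
        A = eqCoeff N
            (withZeroth (1 / 2 *
              binom (2 * n + 2 * α + 3) (2 * (n : ℤ) - 1)) e)
            (1 - X ^ 2)
            (-(C (1 / 2) * (C (2 * α - 1) + C (2 * α + 5) * X)))
            (C (1 / 2 * n * (2 * n + 2 * α + 3))) →
          ((¬ ∃ k : ℕ, α = k) → diffOrder A = ⊤) ∧
          (∀ k : ℕ, α = k → diffOrder A = ((2 * k + 4 : ℕ) : ℕ∞)))) := by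
  have h3 : 2 * α + 3 ≠ 0 := by linarith
  have hC8 : (C (1 / 8) : ℝ[X]) ≠ 0 := by rw [Ne, C_eq_zero]; norm_num
  have hC83 : (C (1 / (8 * (2 * α + 3))) : ℝ[X]) ≠ 0 := by
    rw [Ne, C_eq_zero]; exact one_div_ne_zero (mul_ne_zero (by norm_num) h3)
  refine ⟨?_, ?_⟩
  · choose δ hδd hδ using fun j => exists_eq_comp_of_even (dPoly_comp_neg_X α j)
      (natDegree_dPoly_le α j)
    refine ⟨fun j => C (1 / 8) * δ j, fun j hj => ⟨(natDegree_C_mul_le _ _).trans (hδd j),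
      fun t ht => ?_⟩, fun N hN P hP n t => ?_, fun N hN n A hA => ?_⟩
    · rw [← eval_dPoly α hj, hδ j, eval_mul, eval_C, eval_comp,
        eval_sqrt_two_mul_X_sq_sub_one ht]
    · exact differential_equation_neg_half hδ (hP.satisfiesPerturbed_comp hα hN n) t
    · rw [hA]
      refine diffOrder_eqCoeff hN _ _ _ (fun h j hj => mul_ne_zero hC8 fun h0 => ?_)
        fun k hk => ⟨mul_ne_zero hC8 fun h0 => ?_, fun j hj => ?_⟩
      · exact dPoly_ne_zero hα h hj (by rw [hδ j, h0, zero_comp])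
      · exact dPoly_natCast_ne_zero k (by rw [← hk, hδ, h0, zero_comp])
      · have h := dPoly_natCast_eq_zero k hj
        rw [← hk, hδ j] at h
        rw [eq_zero_of_comp_eq_zero h, mul_zero]
  · choose δ hδd hδ using fun j => exists_eq_X_mul_comp_of_odd (xePoly_comp_neg_X α j)
      (natDegree_xePoly_le α j)
    refine ⟨fun j => C (1 / (8 * (2 * α + 3))) * δ j, fun j hj =>
      ⟨(natDegree_C_mul_le _ _).trans (hδd j), fun t ht => ?_⟩, fun N hN P hP n t => ?_,
      fun N hN n A hA => ?_⟩
    · have hx : Real.sqrt ((1 + t) / 2) ≠ 0 := (Real.sqrt_pos.2 (by linarith)).ne'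
      have h := eval_xePoly α hj hx
      rw [hδ j, eval_mul, eval_X, eval_comp] at h
      have h := mul_left_cancel₀ hx h
      rw [← h, eval_mul, eval_C, eval_sqrt_two_mul_X_sq_sub_one ht.le]
    · exact differential_equation_half hα hδ (hP.satisfiesPerturbed_X_mul_comp hα hN n) t
    · rw [hA]
      refine diffOrder_eqCoeff hN _ _ _ (fun h j hj => mul_ne_zero hC83 fun h0 => ?_)
        fun k hk => ⟨mul_ne_zero hC83 fun h0 => ?_, fun j hj => ?_⟩
      · exact xePoly_ne_zero hα h hj (by rw [hδ j, h0, zero_comp, mul_zero])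
      · exact xePoly_natCast_ne_zero k (by rw [← hk, hδ, h0, zero_comp, mul_zero])
      · have h := xePoly_natCast_eq_zero k hj
        rw [← hk, hδ j] at h
        rw [eq_zero_of_comp_eq_zero ((mul_eq_zero.1 h).resolve_left X_ne_zero), mul_zero]
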